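/- Let $T$ be an acute triangle in the Euclidean plane. A \emph{reptiling} of $T$ is a subdivision of $T$ into finitely many, and at least two, figures (tiles) with pairwise disjoint interiors and with union $T$, such that every tile is similar to $T$ and all tiles are mutually congruent (reflected copies are allowed). It is \emph{$k$-splitting}, for an integer $k \ge 2$, if exactly $k$ of its tiles meet in one of the vertices of $T$, that is, if some vertex of $T$ belongs to exactly $k$ tiles. Then, for every $k \geq 3$, the triangle $T$ admits no $k$-splitting reptiling. -/

import Mathlib

/-- The Euclidean plane. -/
abbrev Plane : Type := EuclideanSpace ℝ (Fin 2)

/-- Two figures (point sets) in the plane are similar: a similarity of the plane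
(orientation preserving or not) maps the first onto the second. -/
def SimilarFigures (S S' : Set Plane) : Prop :=
  ∃ f : Plane ≃ᵈ Plane, f '' S = S'

/-- Two figures in the plane are congruent: an isometry of the plane
(orientation preserving or not) maps the first onto the second. -/
def CongruentFigures (S S' : Set Plane) : Prop :=
  ∃ f : Plane ≃ᵢ Plane, f '' S = S'

/-- An `r`-gentiling of the figure `S`: a subdivision of `S` into `r ≥ 2` figures (tiles) with
pairwise disjoint interiors, each of which is similar to `S`. -/
structure IsGentiling {r : ℕ} (S : Set Plane) (tile : Fin r → Set Plane) : Prop where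
  two_le : 2 ≤ r
  iUnion_eq : ⋃ i, tile i = S
  disjoint_interior : ∀ i j, i ≠ j → Disjoint (interior (tile i)) (interior (tile j))
  similar : ∀ i, SimilarFigures S (tile i)

/-- An `r`-reptiling of the figure `S`: an `r`-gentiling whose tiles are mutually congruent. -/
structure IsReptiling {r : ℕ} (S : Set Plane) (tile : Fin r → Set Plane) : Prop
    extends IsGentiling S tile where
  congruent : ∀ i j, CongruentFigures (tile i) (tile j)

/-- A gentiling of the triangle `T` is `k`-splitting, `k ≥ 2`: exactly `k` tiles meet in one of the
vertices of `T`. -/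
def IsSplitting {r : ℕ} (k : ℕ) (T : Affine.Triangle ℝ Plane) (tile : Fin r → Set Plane) : Prop :=
  2 ≤ k ∧ ∃ v : Fin 3, {i | T.points v ∈ tile i}.ncard = k

/-! Since T is acute, a tile containing a vertex of T must have a corner there, and the k ≥ 3
corners at the split vertex must be copies of a single angle α belonging to another vertex
(`exists_split_angle`). So the angles of T are α, β = π − (k+1)α and γ = kα, and acuteness of β and
γ says 2kα < π < 2(k+1)α.

The main argument is a double count. Over the whole tiling each of the three angles occurs equally
often, once per tile, so integer weights on α, β, γ with sum zero give total weight zero. At a tile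
corner that is not a vertex of T the corners add up to π or 2π; the corners at the three vertices of
T together add up to π and include at least k+1 copies of α. `exists_balancing_weights` finds
weights that are nonnegative on all combinations of the first kind and positive on the second, and
`false_of_weights` draws the contradiction. Few combinations exist because π/α is confined to an
interval of length 2, but the weights depend on whether 2π/α is one of 4k+1, 4k+2, 4k+3.

This leaves k = 3 with 13α = 2π or 15α = 2π. There sin α, sin 4α, sin 3α, hence the sides of T, are
linearly independent over ℚ (`sin_linear_independent_rat`). Counting tile sides along each side of T
gives a rational matrix with the side vector as eigenvector and with square r times the identity,
which forces it to be diagonal: each side of T is covered by the corresponding tile sides only. Near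
the split vertex, the side of T opposite α is then covered by a tile side opposite α, although every
tile there has its corner α at that vertex (`exists_edge_at_vertex`, `ncard_vertex_lt_three`). -/

/-! ### Combinations of the angles α, p − (k+1)α, kα with sum p or 2p, where p stands for π -/

section AngleArithmetic

variable {k a b c : ℕ} {p α : ℝ}

/-- Once b is fixed, (1 − b)p is an integer multiple of α, and p/α lies strictly between 2k and
2k+2. So either p cancels (b = 1) or p/α is forced to be 2k+1. -/
theorem straight_angle_sum_cases (hk : 3 ≤ k) (h1 : 2 * k * α < p) (h2 : p < 2 * (k + 1) * α)
    (h : a * α + b * (p - (k + 1) * α) + c * (k * α) = p) :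
    (b = 1 ∧ a + c * k = k + 1) ∨ ((2 * k + 1) * α = p ∧
      ((b = 0 ∧ a + c * k = 2 * k + 1) ∨ (b = 2 ∧ a + c * k = 1))) := by
  have hα : 0 < α := by linarith
  have hk' : (3 : ℝ) ≤ k := by exact_mod_cast hk
  have hkα := mul_nonneg (sub_nonneg.2 hk') hα.le
  -- Three copies of the middle angle exceed p by more than (k − 3)α; this uses 3 ≤ k.
  have hb3 : b < 3 := by
    by_contra hb
    have hb : (3 : ℝ) ≤ b := by exact_mod_cast not_lt.1 hb
    have h3 : 0 ≤ a * α + c * (k * α) := by positivity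
    have h4 : (3 : ℝ) * (p - (k + 1) * α) ≤ b * (p - (k + 1) * α) :=
      mul_le_mul_of_nonneg_right hb (by linarith)
    linarith
  have hlt : ∀ x y : ℤ, (x : ℝ) * α < y * α → x < y := fun x y hxy => by
    exact_mod_cast lt_of_mul_lt_mul_right hxy hα.le
  have heq : ∀ x y : ℤ, (x : ℝ) * α = y * α → x = y := fun x y hxy => by
    exact_mod_cast mul_right_cancel₀ hα.ne' hxy
  -- As the third angle is kα, only n, the total multiple of α, matters.
  obtain ⟨n, hn⟩ : ∃ n, n = a + c * k := ⟨_, rfl⟩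
  have hnR : (n : ℝ) = a + c * k := by exact_mod_cast hn
  have h' : n * α + b * (p - (k + 1) * α) = p := by rw [hnR]; linarith
  rw [← hn]
  interval_cases b <;> push_cast at h'
  · have e1 := hlt (2 * k) n (by push_cast; linarith)
    have e2 := hlt n (2 * (k + 1)) (by push_cast; linarith)
    have e3 : n = 2 * k + 1 := by omega
    refine Or.inr ⟨?_, Or.inl ⟨rfl, e3⟩⟩
    rw [e3] at h'; push_cast at h'; linarith
  · have e1 := heq n (k + 1) (by push_cast; linarith)
    exact Or.inl ⟨rfl, by omega⟩
  · have e1 := hlt (2 * k) (2 * (k + 1) - n) (by push_cast; linarith)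
    have e2 := hlt (2 * (k + 1) - n) (2 * (k + 1)) (by push_cast; linarith)
    have e3 : n = 1 := by omega
    refine Or.inr ⟨?_, Or.inr ⟨rfl, e3⟩⟩
    rw [e3] at h'; push_cast at h'; linarith

/-- Now (2 − b)p is an integer multiple of α, so p cancels for b = 2, while b = 0 and b = 4 also
allow the half-integral values of p/α. The case b = 5 is kept apart: it needs 3p/α to be an integer,
and then leaves room for at most one further α. -/
theorem full_angle_sum_cases (hk : 3 ≤ k) (h1 : 2 * k * α < p) (h2 : p < 2 * (k + 1) * α)
    (h : a * α + b * (p - (k + 1) * α) + c * (k * α) = 2 * p) :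
    (b = 2 ∧ a + c * k = 2 * k + 2) ∨
    ((2 * k + 1) * α = p ∧
      ((b = 0 ∧ a + c * k = 4 * k + 2) ∨ (b = 1 ∧ a + c * k = 3 * k + 2) ∨
        (b = 3 ∧ a + c * k = k + 2) ∨ (b = 4 ∧ a + c * k = 2))) ∨
    ((4 * k + 1) * α = 2 * p ∧ ((b = 0 ∧ a + c * k = 4 * k + 1) ∨ (b = 4 ∧ a + c * k = 3))) ∨
    ((4 * k + 3) * α = 2 * p ∧ ((b = 0 ∧ a + c * k = 4 * k + 3) ∨ (b = 4 ∧ a + c * k = 1))) ∨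
    ((2 * k + 1) * α ≠ p ∧ (4 * k + 1) * α ≠ 2 * p ∧ (4 * k + 3) * α ≠ 2 * p ∧
      b = 5 ∧ a + c * k ≤ 1) := by
  have hα : 0 < α := by linarith
  have hk' : (3 : ℝ) ≤ k := by exact_mod_cast hk
  have hkα := mul_nonneg (sub_nonneg.2 hk') hα.le
  have hb3 : b < 6 := by
    by_contra hb
    have hb : (6 : ℝ) ≤ b := by exact_mod_cast not_lt.1 hb
    have h3 : 0 ≤ a * α + c * (k * α) := by positivity
    have h4 : (6 : ℝ) * (p - (k + 1) * α) ≤ b * (p - (k + 1) * α) :=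
      mul_le_mul_of_nonneg_right hb (by linarith)
    linarith
  have hlt : ∀ x y : ℤ, (x : ℝ) * α < y * α → x < y := fun x y hxy => by
    exact_mod_cast lt_of_mul_lt_mul_right hxy hα.le
  have heq : ∀ x y : ℤ, (x : ℝ) * α = y * α → x = y := fun x y hxy => by
    exact_mod_cast mul_right_cancel₀ hα.ne' hxy
  obtain ⟨n, hn⟩ : ∃ n, n = a + c * k := ⟨_, rfl⟩
  have hnR : (n : ℝ) = a + c * k := by exact_mod_cast hn
  have h' : n * α + b * (p - (k + 1) * α) = 2 * p := by rw [hnR]; linarith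
  rw [← hn]
  interval_cases b <;> push_cast at h'
  · have e1 := hlt (4 * k) n (by push_cast; linarith)
    have e2 := hlt n (4 * (k + 1)) (by push_cast; linarith)
    have e3 : n = 4 * k + 1 ∨ n = 4 * k + 2 ∨ n = 4 * k + 3 := by omega
    rcases e3 with e | e | e
    · refine Or.inr (Or.inr (Or.inl ⟨?_, Or.inl ⟨rfl, e⟩⟩))
      rw [e] at h'; push_cast at h'; linarith
    · refine Or.inr (Or.inl ⟨?_, Or.inl ⟨rfl, e⟩⟩)
      rw [e] at h'; push_cast at h'; linarith
    · refine Or.inr (Or.inr (Or.inr (Or.inl ⟨?_, Or.inl ⟨rfl, e⟩⟩)))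
      rw [e] at h'; push_cast at h'; linarith
  · have e1 := hlt (2 * k) (n - (k + 1)) (by push_cast; linarith)
    have e2 := hlt (n - (k + 1)) (2 * (k + 1)) (by push_cast; linarith)
    have e3 : n = 3 * k + 2 := by omega
    refine Or.inr (Or.inl ⟨?_, Or.inr (Or.inl ⟨rfl, e3⟩)⟩)
    rw [e3] at h'; push_cast at h'; linarith
  · have e1 := heq n (2 * (k + 1)) (by push_cast; linarith)
    exact Or.inl ⟨rfl, by omega⟩
  · have e1 := hlt (2 * k) (3 * (k + 1) - n) (by push_cast; linarith)
    have e2 := hlt (3 * (k + 1) - n) (2 * (k + 1)) (by push_cast; linarith)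
    have e3 : n = k + 2 := by omega
    refine Or.inr (Or.inl ⟨?_, Or.inr (Or.inr (Or.inl ⟨rfl, e3⟩))⟩)
    rw [e3] at h'; push_cast at h'; linarith
  · have e1 := hlt (4 * k) (4 * (k + 1) - n) (by push_cast; linarith)
    have e2 := hlt (4 * (k + 1) - n) (4 * (k + 1)) (by push_cast; linarith)
    have e3 : n = 1 ∨ n = 2 ∨ n = 3 := by omega
    rcases e3 with e | e | e
    · refine Or.inr (Or.inr (Or.inr (Or.inl ⟨?_, Or.inr ⟨rfl, e⟩⟩)))
      rw [e] at h'; push_cast at h'; linarith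
    · refine Or.inr (Or.inl ⟨?_, Or.inr (Or.inr (Or.inr ⟨rfl, e⟩))⟩)
      rw [e] at h'; push_cast at h'; linarith
    · refine Or.inr (Or.inr (Or.inl ⟨?_, Or.inr ⟨rfl, e⟩⟩))
      rw [e] at h'; push_cast at h'; linarith
  · have e1 := hlt (6 * k) (5 * (k + 1) - n) (by push_cast; linarith)
    refine Or.inr (Or.inr (Or.inr (Or.inr ⟨fun hM => ?_, fun hM => ?_, fun hM => ?_, rfl, ?_⟩)))
    · have := heq (5 * (k + 1) - n) (6 * k + 3) (by push_cast; linarith)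
      omega
    · have := heq (2 * (5 * (k + 1) - n)) (3 * (4 * k + 1)) (by push_cast; linarith)
      omega
    · have := heq (2 * (5 * (k + 1) - n)) (3 * (4 * k + 3)) (by push_cast; linarith)
      omega
    · omega

theorem exists_balancing_weights (hk : 3 ≤ k) (h1 : 2 * k * α < p)
    (h2 : p < 2 * (k + 1) * α) (hex : ¬ (k = 3 ∧ (13 * α = 2 * p ∨ 15 * α = 2 * p))) :
    ∃ u v w : ℤ, u + v + w = 0 ∧
      (∀ a b c : ℕ, a * α + b * (p - (k + 1) * α) + c * (k * α) = p ∨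
        a * α + b * (p - (k + 1) * α) + c * (k * α) = 2 * p → 0 ≤ u * a + v * b + w * c) ∧
      (∀ a b c : ℕ, a * α + b * (p - (k + 1) * α) + c * (k * α) = p → k + 1 ≤ a →
        0 < u * a + v * b + w * c) := by
  have hα : 0 < α := by linarith
  -- A numerical bound on c makes c * k linear after `interval_cases`, within reach of `omega`.
  have hc6 : ∀ a c n : ℕ, a + c * k = n → n < 6 * k → c < 6 := fun a c n h hn => by
    by_contra hc
    have := Nat.mul_le_mul_right k (not_lt.1 hc)
    omega
  by_cases hM0 : (2 * k + 1) * α = p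
  · have hM1 : (4 * k + 1) * α ≠ 2 * p := fun h => by linarith
    have hM3 : (4 * k + 3) * α ≠ 2 * p := fun h => by linarith
    -- Here the second and third angles coincide, so their weights may be equal.
    refine ⟨2, -1, -1, by norm_num, fun a b c h => ?_, fun a b c h ha => ?_⟩
    · rcases h with h | h
      · rcases straight_angle_sum_cases hk h1 h2 h with ⟨hb, hn⟩ | ⟨-, ⟨hb, hn⟩ | ⟨hb, hn⟩⟩ <;>
        · have := hc6 a c _ hn (by omega)
          interval_cases c <;> omega
      · rcases full_angle_sum_cases hk h1 h2 h with ⟨hb, hn⟩ | ⟨-, ⟨hb, hn⟩ | ⟨hb, hn⟩ |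
          ⟨hb, hn⟩ | ⟨hb, hn⟩⟩ | ⟨hM, -⟩ | ⟨hM, -⟩ | ⟨hM, -⟩
        iterate 5
          have := hc6 a c _ hn (by omega)
          interval_cases c <;> omega
        · exact absurd hM hM1
        · exact absurd hM hM3
        · exact absurd hM0 hM
    · rcases straight_angle_sum_cases hk h1 h2 h with ⟨hb, hn⟩ | ⟨-, ⟨hb, hn⟩ | ⟨hb, hn⟩⟩ <;>
        · have := hc6 a c _ hn (by omega)
          interval_cases c <;> omega
  by_cases hM1 : (4 * k + 1) * α = 2 * p
  · have hM3 : (4 * k + 3) * α ≠ 2 * p := fun h => by linarith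
    have hk4 : 4 ≤ k := by
      by_contra hlt
      obtain rfl : k = 3 := by omega
      exact hex ⟨rfl, Or.inl (by push_cast at hM1; linarith)⟩
    -- Here β = (k − 1/2)α. The weights vanish on 3α + 4β and on α + 4γ, both equal to 2p. For k = 3
    -- the first could also be γ + 4β, of negative weight; hence `hk4`.
    refine ⟨4, -3, -1, by norm_num, fun a b c h => ?_, fun a b c h ha => ?_⟩
    · rcases h with h | h
      · rcases straight_angle_sum_cases hk h1 h2 h with ⟨hb, hn⟩ | ⟨hM, -⟩
        · have := hc6 a c _ hn (by omega)
          interval_cases c <;> omega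
        · exact absurd hM hM0
      · rcases full_angle_sum_cases hk h1 h2 h with ⟨hb, hn⟩ | ⟨hM, -⟩ |
          ⟨-, ⟨hb, hn⟩ | ⟨hb, hn⟩⟩ | ⟨hM, -⟩ | ⟨-, hM, -⟩
        · have := hc6 a c _ hn (by omega)
          interval_cases c <;> omega
        · exact absurd hM hM0
        iterate 2
          have := hc6 a c _ hn (by omega)
          interval_cases c <;> omega
        · exact absurd hM hM3
        · exact absurd hM1 hM
    · rcases straight_angle_sum_cases hk h1 h2 h with ⟨hb, hn⟩ | ⟨hM, -⟩
      · have := hc6 a c _ hn (by omega)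
        interval_cases c <;> omega
      · exact absurd hM hM0
  by_cases hM3 : (4 * k + 3) * α = 2 * p
  · have hk4 : 4 ≤ k := by
      by_contra hlt
      obtain rfl : k = 3 := by omega
      exact hex ⟨rfl, Or.inr (by push_cast at hM3; linarith)⟩
    -- Here β = (k + 1/2)α. The weights vanish on α + 4β and on 3α + 4γ, both equal to 2p. For k = 3
    -- the second could also be 5γ, of negative weight.
    refine ⟨4, -1, -3, by norm_num, fun a b c h => ?_, fun a b c h ha => ?_⟩
    · rcases h with h | h
      · rcases straight_angle_sum_cases hk h1 h2 h with ⟨hb, hn⟩ | ⟨hM, -⟩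
        · have := hc6 a c _ hn (by omega)
          interval_cases c <;> omega
        · exact absurd hM hM0
      · rcases full_angle_sum_cases hk h1 h2 h with ⟨hb, hn⟩ | ⟨hM, -⟩ |
          ⟨hM, -⟩ | ⟨-, ⟨hb, hn⟩ | ⟨hb, hn⟩⟩ | ⟨-, -, hM, -⟩
        · have := hc6 a c _ hn (by omega)
          interval_cases c <;> omega
        · exact absurd hM hM0
        · exact absurd hM hM1
        iterate 2
          have := hc6 a c _ hn (by omega)
          interval_cases c <;> omega
        · exact absurd hM3 hM
    · rcases straight_angle_sum_cases hk h1 h2 h with ⟨hb, hn⟩ | ⟨hM, -⟩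
      · have := hc6 a c _ hn (by omega)
        interval_cases c <;> omega
      · exact absurd hM hM0
  -- For all other ratios γ never outnumbers β: b is 1, 2 or 5, and since k ≥ 3, c is then at most
  -- 1, 2 or 0.
  refine ⟨0, 1, -1, by norm_num, fun a b c h => ?_, fun a b c h ha => ?_⟩
  · rcases h with h | h
    · rcases straight_angle_sum_cases hk h1 h2 h with ⟨hb, hn⟩ | ⟨hM, -⟩
      · have := hc6 a c _ hn (by omega)
        interval_cases c <;> omega
      · exact absurd hM hM0
    · rcases full_angle_sum_cases hk h1 h2 h with ⟨hb, hn⟩ | ⟨hM, -⟩ |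
        ⟨hM, -⟩ | ⟨hM, -⟩ | ⟨-, -, -, hb, hn⟩
      · have := hc6 a c _ hn (by omega)
        interval_cases c <;> omega
      · exact absurd hM hM0
      · exact absurd hM hM1
      · exact absurd hM hM3
      · have := hc6 a c _ rfl (by omega)
        interval_cases c <;> omega
  · rcases straight_angle_sum_cases hk h1 h2 h with ⟨hb, hn⟩ | ⟨hM, -⟩
    · have := hc6 a c _ hn (by omega)
      interval_cases c <;> omega
    · exact absurd hM hM0

end AngleArithmetic

/-! ### Rationality arguments for the two exceptional triangles -/

/-- By independence of the entries of e, the relation X²e = re gives X² = r. The size 3 is odd, so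
det X² = r³ makes r a rational square and s rational; independence applied to Xe = se then gives X =
s. -/
theorem Matrix.eq_zero_of_real_eigenvector_sq {e : Fin 3 → ℝ}
    (he : ∀ q : Fin 3 → ℚ, ∑ j, (q j : ℝ) * e j = 0 → q = 0)
    (X : Matrix (Fin 3) (Fin 3) ℚ) {s : ℝ} {r : ℕ} (hr : r ≠ 0) (hs : s ^ 2 = r)
    (hX : ∀ i, s * e i = ∑ j, (X i j : ℝ) * e j) {i j : Fin 3} (hij : i ≠ j) : X i j = 0 := by
  have hr' : (r : ℚ) ≠ 0 := by exact_mod_cast hr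
  have hsq : X * X = (r : ℚ) • (1 : Matrix (Fin 3) (Fin 3) ℚ) := by
    ext a b
    have h := he (fun b => (X * X) a b - (r : ℚ) * (1 : Matrix (Fin 3) (Fin 3) ℚ) a b) ?_
    · have := congrFun h b
      simp only [Pi.zero_apply, sub_eq_zero] at this
      rw [this]; simp
    · have h1 : ∑ b, (((X * X) a b : ℚ) : ℝ) * e b = s * (s * e a) := by
        calc ∑ b, (((X * X) a b : ℚ) : ℝ) * e b = ∑ b, ∑ c, (X a c : ℝ) * (X c b * e b) := by
              refine Finset.sum_congr rfl fun b _ => ?_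
              rw [Matrix.mul_apply]; push_cast; rw [Finset.sum_mul]
              exact Finset.sum_congr rfl fun c _ => by ring
          _ = ∑ c, (X a c : ℝ) * (s * e c) := by
              rw [Finset.sum_comm]
              exact Finset.sum_congr rfl fun c _ => by rw [hX c, Finset.mul_sum]
          _ = s * (s * e a) := by
              rw [hX a, Finset.mul_sum]
              exact Finset.sum_congr rfl fun c _ => by ring
      have h2 : ∑ b, (((r : ℚ) * (1 : Matrix (Fin 3) (Fin 3) ℚ) a b : ℚ) : ℝ) * e b
          = r * e a := by
        rw [Finset.sum_eq_single a (fun b _ hb => by simp [Matrix.one_apply_ne hb.symm])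
          (by simp)]
        simp
      push_cast at h1 h2 ⊢
      simp only [sub_mul, Finset.sum_sub_distrib]
      rw [h1, h2, ← hs]; ring
  have hdet : X.det ^ 2 = (r : ℚ) ^ 3 := by
    have := congrArg Matrix.det hsq
    rw [Matrix.det_mul, Matrix.det_smul, Matrix.det_one] at this
    simpa [sq] using this
  obtain ⟨q, hq⟩ : ∃ q : ℚ, s = q := by
    have h1 : s ^ 2 = ((X.det / r : ℚ) : ℝ) ^ 2 := by
      rw [hs, ← Rat.cast_pow, div_pow, hdet]
      have : (r : ℚ) ^ 3 / r ^ 2 = r := by field_simp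
      rw [this]; simp
    rcases sq_eq_sq_iff_eq_or_eq_neg.1 h1 with h | h
    · exact ⟨_, h⟩
    · exact ⟨-(X.det / r), by rw [h]; push_cast; ring⟩
  have h := he (fun b => X i b - q * (1 : Matrix (Fin 3) (Fin 3) ℚ) i b) ?_
  · simpa [hij] using congrFun h j
  · have h2 : ∑ b, ((q * (1 : Matrix (Fin 3) (Fin 3) ℚ) i b : ℚ) : ℝ) * e b = q * e i := by
      rw [Finset.sum_eq_single i (fun b _ hb => by simp [Matrix.one_apply_ne hb.symm])
        (by simp)]
      simp
    push_cast at h2 ⊢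
    simp only [sub_mul, Finset.sum_sub_distrib]
    rw [h2, ← hX i, hq]; ring

-- With ζ = exp(iα), a primitive n-th root of unity, ζ⁴ times the relation is a rational polynomial
-- of degree at most 8 vanishing at ζ. For n = 13 the minimal polynomial has degree 12. For n = 15
-- it has degree 8, which leaves a multiple of the cyclotomic polynomial to be excluded.
open Polynomial in
theorem sin_linear_independent_rat {n : ℕ} (hn : n = 13 ∨ n = 15) {α : ℝ}
    (hα : n * α = 2 * Real.pi) {x y z : ℚ}
    (h : x * Real.sin α + y * Real.sin (4 * α) + z * Real.sin (3 * α) = 0) :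
    x = 0 ∧ y = 0 ∧ z = 0 := by
  have hn0 : n ≠ 0 := by rcases hn with rfl | rfl <;> norm_num
  have hnC : (n : ℂ) ≠ 0 := by exact_mod_cast hn0
  set ζ : ℂ := Complex.exp (α * Complex.I) with hζ
  have hprim : IsPrimitiveRoot ζ n := by
    have := Complex.isPrimitiveRoot_exp n hn0
    convert! this using 2
    have hα' : (n : ℂ) * α = 2 * Real.pi := by exact_mod_cast hα
    field_simp
    linear_combination hα'
  have hsin : ∀ j : ℕ, j ≤ 4 →
      ζ ^ (4 + j) - ζ ^ (4 - j) = 2 * Complex.I * ζ ^ 4 * (Real.sin (j * α) : ℂ) := by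
    intro j hj
    obtain ⟨i, hi⟩ : ∃ i, 4 = i + j := ⟨4 - j, by omega⟩
    rw [hi]
    have e : ζ ^ j * Complex.exp (-((j * α : ℝ) : ℂ) * Complex.I) = 1 := by
      rw [hζ, ← Complex.exp_nat_mul, ← Complex.exp_add]
      simp [mul_assoc]
    have e' : ζ ^ j = Complex.exp (((j * α : ℝ) : ℂ) * Complex.I) := by
      rw [hζ, ← Complex.exp_nat_mul]; simp [mul_assoc]
    rw [Complex.ofReal_sin, Complex.sin, ← e', Nat.add_sub_cancel, pow_add, pow_add]
    linear_combination ζ ^ i * e -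
      ζ ^ i * ζ ^ j * (Complex.exp (-((j * α : ℝ) : ℂ) * Complex.I) - ζ ^ j) * Complex.I_sq
  set P : ℚ[X] := C x * (X ^ 5 - X ^ 3) + C y * (X ^ 8 - 1) + C z * (X ^ 7 - X) with hP
  have hPζ : aeval ζ P = 0 := by
    have h1 := hsin 1 (by norm_num)
    have h4 := hsin 4 (by norm_num)
    have h3 := hsin 3 (by norm_num)
    norm_num at h1 h4 h3
    have hC : (x : ℂ) * Complex.sin α + y * Complex.sin (4 * α) + z * Complex.sin (3 * α) = 0 := by
      exact_mod_cast congrArg (fun t : ℝ => (t : ℂ)) h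
    simp only [hP, map_add, map_mul, map_sub, map_pow, aeval_X, aeval_C, map_one,
      eq_ratCast]
    linear_combination (x : ℂ) * h1 + (y : ℂ) * h4 + (z : ℂ) * h3 + 2 * Complex.I * ζ ^ 4 * hC
  have hmin : cyclotomic n ℚ = minpoly ℚ ζ :=
    cyclotomic_eq_minpoly_rat hprim (Nat.pos_of_ne_zero hn0)
  have hzero : ∀ Q : ℚ[X], aeval ζ Q = 0 → Q.degree < (cyclotomic n ℚ).degree → Q = 0 := by
    intro Q hQ hd
    by_contra hQ0
    rw [hmin] at hd
    exact absurd (minpoly.degree_le_of_ne_zero ℚ ζ hQ0 hQ) (not_le.2 hd)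
  have hdegP : P.degree ≤ 8 := by rw [hP]; compute_degree
  have hcoeff : P = 0 → x = 0 ∧ y = 0 ∧ z = 0 := by
    intro h0
    have c5 := congrArg (fun Q : ℚ[X] => Q.coeff 5) h0
    have c8 := congrArg (fun Q : ℚ[X] => Q.coeff 8) h0
    have c7 := congrArg (fun Q : ℚ[X] => Q.coeff 7) h0
    simp [hP, coeff_X, coeff_one, coeff_X_pow] at c5 c8 c7
    exact ⟨c5, c8, c7⟩
  rcases hn with rfl | rfl
  · refine hcoeff (hzero P hPζ (lt_of_le_of_lt hdegP ?_))
    rw [degree_cyclotomic, Nat.totient_prime (by norm_num)]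
    norm_num
  · have htot : Nat.totient 15 = 8 := by decide
    -- By leading coefficients P would be y times the cyclotomic polynomial, but the constant terms
    -- are −y and y.
    have hy : y = 0 := by
      have hQ := hzero (P - C y * cyclotomic 15 ℚ) ?_ ?_
      · have := congrArg (fun Q : ℚ[X] => Q.coeff 0) hQ
        simp [hP, coeff_X, coeff_one, coeff_X_pow, cyclotomic_coeff_zero] at this
        linarith
      · rw [map_sub, hPζ, map_mul, hmin, minpoly.aeval]; simp
      · rw [degree_cyclotomic, htot]
        refine lt_of_le_of_ne ?_ ?_
        · refine (degree_sub_le _ _).trans (max_le hdegP ?_)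
          refine (degree_mul_le _ _).trans ?_
          rw [degree_cyclotomic, htot]
          exact (add_le_add_left degree_C_le _).trans (by simp)
        · intro hd
          have h8 : (P - C y * cyclotomic 15 ℚ).coeff 8 = 0 := by
            have hl : (cyclotomic 15 ℚ).coeff 8 = 1 := by
              have := (cyclotomic.monic 15 ℚ).coeff_natDegree
              rwa [natDegree_cyclotomic, htot] at this
            rw [coeff_sub, coeff_C_mul, hl]
            simp [hP, coeff_X, coeff_one, coeff_X_pow]
          exact coeff_ne_zero_of_eq_degree hd h8
    apply hcoeff
    refine hzero P hPζ ?_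
    rw [degree_cyclotomic, htot]
    have : P.degree ≤ 7 := by rw [hP, hy]; simp only [map_zero, zero_mul, add_zero]; compute_degree
    exact lt_of_le_of_lt this (by norm_num)

/-! ### Angles measured by area near a point -/

open MeasureTheory Metric Set Filter Topology

/-- Integration in polar coordinates. Directions are tested only in the open interval (−π, π), as
the negative real axis is a null set. -/
theorem Complex.volume_sector_inter_ball {S : Set ℂ} (hS : MeasurableSet S) {J : Set ℝ}
    (hJ : MeasurableSet J)
    (h : ∀ t : ℝ, 0 < t → ∀ φ ∈ Ioo (-Real.pi) Real.pi,
      ((t : ℂ) * (Real.cos φ + Real.sin φ * Complex.I) ∈ S ↔ φ ∈ J))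
    {ε : ℝ} (hε : 0 < ε) :
    volume.real (S ∩ ball 0 ε) = volume.real (J ∩ Ioo (-Real.pi) Real.pi) * (ε ^ 2 / 2) := by
  have hA : MeasurableSet (S ∩ ball (0 : ℂ) ε) := hS.inter measurableSet_ball
  have hR : MeasurableSet (Ioo (0 : ℝ) ε ×ˢ (J ∩ Ioo (-Real.pi) Real.pi)) :=
    measurableSet_Ioo.prod (hJ.inter measurableSet_Ioo)
  have key : volume (S ∩ ball 0 ε)
      = ENNReal.ofReal (ε ^ 2 / 2) * volume (J ∩ Ioo (-Real.pi) Real.pi) := by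
    rw [← lintegral_indicator_one hA, ← Complex.lintegral_comp_polarCoord_symm]
    have hset : ∫⁻ p in polarCoord.target, ENNReal.ofReal p.1 •
          (S ∩ ball (0 : ℂ) ε).indicator (1 : ℂ → ENNReal) (Complex.polarCoord.symm p)
        = ∫⁻ p in polarCoord.target, (Ioo (0 : ℝ) ε ×ˢ (J ∩ Ioo (-Real.pi) Real.pi)).indicator
            (fun p : ℝ × ℝ => ENNReal.ofReal p.1) p := by
      refine setLIntegral_congr_fun polarCoord.open_target.measurableSet ?_
      rintro ⟨t, φ⟩ hp
      simp only [polarCoord_target, mem_prod, mem_Ioi] at hp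
      have h1 := h t hp.1 φ hp.2
      have hnorm : ‖Complex.polarCoord.symm (t, φ)‖ = |t| := Complex.norm_polarCoord_symm _
      have h2 : Complex.polarCoord.symm (t, φ) ∈ S ∩ ball (0 : ℂ) ε ↔
          (t, φ) ∈ Ioo (0 : ℝ) ε ×ˢ (J ∩ Ioo (-Real.pi) Real.pi) := by
        rw [mem_inter_iff, mem_ball_zero_iff, hnorm, abs_of_pos hp.1, mem_prod, mem_inter_iff,
          Complex.polarCoord_symm_apply, h1]
        simp only [mem_Ioo]
        have := hp.1
        have := hp.2
        simp only [mem_Ioo] at this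
        tauto
      by_cases hm : (t, φ) ∈ Ioo (0 : ℝ) ε ×ˢ (J ∩ Ioo (-Real.pi) Real.pi)
      · simp only []
        rw [indicator_of_mem hm, indicator_of_mem (h2.2 hm)]
        simp
      · simp only []
        rw [indicator_of_notMem hm, indicator_of_notMem (fun h => hm (h2.1 h))]
        simp
    rw [hset, setLIntegral_indicator hR]
    have hsub : Ioo (0 : ℝ) ε ×ˢ (J ∩ Ioo (-Real.pi) Real.pi) ∩ polarCoord.target
        = Ioo (0 : ℝ) ε ×ˢ (J ∩ Ioo (-Real.pi) Real.pi) := by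
      apply inter_eq_left.2
      rw [polarCoord_target]
      exact prod_mono (fun x hx => hx.1) inter_subset_right
    rw [hsub, Measure.volume_eq_prod, ← Measure.prod_restrict]
    have := lintegral_prod_mul (μ := volume.restrict (Ioo (0 : ℝ) ε))
      (ν := volume.restrict (J ∩ Ioo (-Real.pi) Real.pi))
      (f := fun t : ℝ => ENNReal.ofReal t) (g := fun _ => 1) (by fun_prop) (by fun_prop)
    simp only [mul_one] at this
    rw [this]
    simp only [lintegral_const, one_mul, Measure.restrict_apply_univ]
    congr 1
    rw [← ofReal_integral_eq_lintegral_ofReal]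
    · rw [← integral_Ioc_eq_integral_Ioo, ← intervalIntegral.integral_of_le hε.le]
      simp
    · exact (continuous_id.integrableOn_Icc (a := 0) (b := ε)).mono_set Ioo_subset_Icc_self
    · filter_upwards [ae_restrict_mem measurableSet_Ioo] with t ht using ht.1.le
  rw [measureReal_def, key, ENNReal.toReal_mul, ENNReal.toReal_ofReal (by positivity), mul_comm]
  rfl

/-- The part of `S` within a small ball around `x` has the area of a disc sector of angle `θ`. -/
def HasAngle (S : Set Plane) (x : Plane) (θ : ℝ) : Prop :=
  ∀ᶠ ε in 𝓝[>] (0 : ℝ), volume.real (S ∩ ball x ε) = θ * (ε ^ 2 / 2)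

theorem HasAngle.unique {S : Set Plane} {x : Plane} {θ θ' : ℝ} (h : HasAngle S x θ)
    (h' : HasAngle S x θ') : θ = θ' := by
  obtain ⟨ε, ⟨h1, h2⟩, h3⟩ := ((h.and h').and self_mem_nhdsWithin).exists
  have : (0 : ℝ) < ε ^ 2 / 2 := by have : 0 < ε := h3; positivity
  exact mul_right_cancel₀ this.ne' (h1.symm.trans h2)

theorem eventually_forall_mem_ball {x : Plane} {p : Plane → Prop} (h : ∀ᶠ y in 𝓝 x, p y) :
    ∀ᶠ ε in 𝓝[>] (0 : ℝ), ∀ y ∈ ball x ε, p y := by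
  obtain ⟨δ, hδ, hp⟩ := Metric.eventually_nhds_iff_ball.1 h
  filter_upwards [Ioo_mem_nhdsGT hδ] with ε hε y hy
  exact hp y (ball_subset_ball hε.2.le hy)

theorem HasAngle.of_not_mem {S : Set Plane} (hS : IsClosed S) {x : Plane} (hx : x ∉ S) :
    HasAngle S x 0 := by
  filter_upwards [eventually_forall_mem_ball (hS.isOpen_compl.mem_nhds hx)] with ε hε
  have : S ∩ ball x ε = ∅ := by
    ext y; constructor
    · rintro ⟨h1, h2⟩; exact hε y h2 h1
    · rintro ⟨⟩
  simp [this]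

theorem HasAngle.of_mem_interior {S : Set Plane} {x : Plane} (hx : x ∈ interior S) :
    HasAngle S x (2 * Real.pi) := by
  filter_upwards [eventually_forall_mem_ball (mem_interior_iff_mem_nhds.1 hx), self_mem_nhdsWithin]
    with ε hε hpos
  have hpos : 0 < ε := hpos
  have : S ∩ ball x ε = ball x ε := inter_eq_right.2 hε
  rw [this, measureReal_def, EuclideanSpace.volume_ball_fin_two]
  simp only [ENNReal.toReal_mul, ENNReal.toReal_pow, ENNReal.toReal_ofReal hpos.le,
    ENNReal.toReal_ofReal Real.pi_pos.le]
  ring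

/-! ### Local angles of a triangle in barycentric coordinates -/

theorem Fin.univ_three_eq {j k l : Fin 3} (hjk : j ≠ k) (hjl : j ≠ l) (hkl : k ≠ l) :
    (Finset.univ : Finset (Fin 3)) = {j, k, l} := by
  revert j k l; decide

theorem Fin.sum_three_of_ne {M : Type*} [AddCommMonoid M] {j k l : Fin 3} (hjk : j ≠ k)
    (hjl : j ≠ l) (hkl : k ≠ l) (f : Fin 3 → M) : ∑ i, f i = f j + f k + f l := by
  rw [Fin.univ_three_eq hjk hjl hkl, Finset.sum_insert (by simp [hjk, hjl]),
    Finset.sum_pair hkl, add_assoc]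

theorem exists_linearIsometryEquiv_complex {u : Plane} (hu : u ≠ 0) (v : Plane) :
    ∃ L : Plane ≃ₗᵢ[ℝ] ℂ, L u = (‖u‖ : ℂ) ∧ 0 ≤ (L v).im := by
  have hL : ∃ L : Plane ≃ₗᵢ[ℝ] ℂ, L u = (‖u‖ : ℂ) := by
    let L₀ : Plane ≃ₗᵢ[ℝ] ℂ := Complex.orthonormalBasisOneI.repr.symm
    have hz : L₀ u ≠ 0 := by simpa using hu
    have hn : ‖L₀ u‖ = ‖u‖ := L₀.norm_map u
    have hun : (‖u‖ : ℂ) ≠ 0 := by exact_mod_cast norm_ne_zero_iff.2 hu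
    refine ⟨L₀.trans (rotation ⟨(starRingEnd ℂ) (L₀ u) / ‖u‖, ?_⟩), ?_⟩
    · refine mem_sphere_zero_iff_norm.2 ?_
      simp [hn, norm_ne_zero_iff.2 hu]
    · change (starRingEnd ℂ) (L₀ u) / ‖u‖ * L₀ u = _
      rw [div_mul_eq_mul_div, mul_comm, Complex.mul_conj, Complex.normSq_eq_norm_sq, hn]
      push_cast
      field_simp
  obtain ⟨L, hLu⟩ := hL
  by_cases h : 0 ≤ (L v).im
  · exact ⟨L, hLu, h⟩
  · refine ⟨L.trans Complex.conjLIE, ?_, ?_⟩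
    · simp [hLu]
    · simp only [LinearIsometryEquiv.trans_apply, Complex.conjLIE_apply, Complex.conj_im]
      linarith

/-- The closed triangle spanned by an affine basis of the plane. -/
abbrev tri (B : AffineBasis (Fin 3) ℝ Plane) : Set Plane := convexHull ℝ (range B)

section

variable (B : AffineBasis (Fin 3) ℝ Plane)

theorem mem_tri_iff {x : Plane} : x ∈ tri B ↔ ∀ j, 0 ≤ B.coord j x := by
  rw [tri, B.convexHull_eq_nonneg_coord]; rfl

theorem mem_interior_tri_iff {x : Plane} : x ∈ interior (tri B) ↔ ∀ j, 0 < B.coord j x := by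
  rw [tri, B.interior_convexHull]; rfl

theorem isCompact_tri : IsCompact (tri B) := (finite_range B).isCompact_convexHull ℝ

theorem continuous_coord (j : Fin 3) : Continuous (B.coord j) :=
  (B.coord j).continuous_of_finiteDimensional

theorem sub_eq_coord_smul {j k l : Fin 3} (hjk : j ≠ k) (hjl : j ≠ l) (hkl : k ≠ l)
    (x y : Plane) : y - x = (B.coord k y - B.coord k x) • (B k - B j)
      + (B.coord l y - B.coord l x) • (B l - B j) := by
  have hy := B.linear_combination_coord_eq_self y
  have hx := B.linear_combination_coord_eq_self x
  have sy := B.sum_coord_apply_eq_one y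
  have sx := B.sum_coord_apply_eq_one x
  rw [Fin.sum_three_of_ne hjk hjl hkl] at hy hx sy sx
  conv_lhs => rw [← hy, ← hx]
  rw [show B.coord j y = 1 - B.coord k y - B.coord l y by linarith,
    show B.coord j x = 1 - B.coord k x - B.coord l x by linarith]
  module

/-- Standard position: one side along the positive real axis and the third vertex above it, so that
near a boundary point the triangle becomes a half-plane or a sector starting at direction 0. -/
theorem exists_adapted_isometry {j k l : Fin 3} (hjk : j ≠ k) (hjl : j ≠ l) (hkl : k ≠ l) :
    ∃ L : Plane ≃ₗᵢ[ℝ] ℂ, L (B k - B j) = (‖B k - B j‖ : ℂ) ∧ 0 < ‖B k - B j‖ ∧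
      0 < (L (B l - B j)).im := by
  have hu : B k - B j ≠ 0 := sub_ne_zero.2 (B.ind.injective.ne hjk.symm)
  obtain ⟨L, h1, h2⟩ := exists_linearIsometryEquiv_complex hu (B l - B j)
  have hpos : 0 < ‖B k - B j‖ := norm_pos_iff.2 hu
  refine ⟨L, h1, hpos, lt_of_le_of_ne h2 fun h0 => ?_⟩
  set c : ℝ := (L (B l - B j)).re / ‖B k - B j‖
  have hv : B l - B j = c • (B k - B j) := by
    apply L.injective
    rw [L.map_smul, h1]
    apply Complex.ext
    · simp [c]; field_simp
    · rw [← h0]; simp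
  have hl : B l = AffineMap.lineMap (B j) (B k) c := by
    rw [AffineMap.lineMap_apply, vsub_eq_sub, vadd_eq_add, ← hv]; abel
  have := congrArg (B.coord l) hl
  rw [AffineMap.apply_lineMap, B.coord_apply_eq, B.coord_apply_ne hjl.symm,
    B.coord_apply_ne hkl.symm] at this
  simp at this

theorem measurePreserving_linearIsometryEquiv_sub (L : Plane ≃ₗᵢ[ℝ] ℂ) (x : Plane) :
    MeasurePreserving (fun y => L (y - x)) volume volume :=
  L.measurePreserving.comp (measurePreserving_sub_right volume x)

theorem hasAngle_of_complex_sector {S : Set Plane} {x : Plane} (L : Plane ≃ₗᵢ[ℝ] ℂ) {A : Set ℂ}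
    (hA : MeasurableSet A) {J : Set ℝ} (hJ : MeasurableSet J)
    (hAJ : ∀ t : ℝ, 0 < t → ∀ φ ∈ Ioo (-Real.pi) Real.pi,
      ((t : ℂ) * (Real.cos φ + Real.sin φ * Complex.I) ∈ A ↔ φ ∈ J))
    (hS : ∀ᶠ y in 𝓝 x, (y ∈ S ↔ L (y - x) ∈ A)) :
    HasAngle S x (volume.real (J ∩ Ioo (-Real.pi) Real.pi)) := by
  filter_upwards [eventually_forall_mem_ball hS, self_mem_nhdsWithin] with ε hε hpos
  rw [← Complex.volume_sector_inter_ball hA hJ hAJ hpos]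
  have : S ∩ ball x ε = (fun y => L (y - x)) ⁻¹' (A ∩ ball 0 ε) := by
    ext y
    simp only [mem_inter_iff, mem_preimage, mem_ball, dist_zero_right, L.norm_map,
      dist_eq_norm y x]
    constructor
    · rintro ⟨h1, h2⟩; exact ⟨(hε y (by simpa [dist_eq_norm] using h2)).1 h1, h2⟩
    · rintro ⟨h1, h2⟩; exact ⟨(hε y (by simpa [dist_eq_norm] using h2)).2 h1, h2⟩
  rw [this, measureReal_def, measureReal_def,
    (measurePreserving_linearIsometryEquiv_sub L x).measure_preimage
      (hA.inter measurableSet_ball).nullMeasurableSet]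

/-- The two other coordinates stay positive near x, so only the sign of coordinate j decides
membership and the triangle is locally a half-plane. -/
theorem hasAngle_edge {j k l : Fin 3} (hjk : j ≠ k) (hjl : j ≠ l) (hkl : k ≠ l) {x : Plane}
    (hj : B.coord j x = 0) (hk : 0 < B.coord k x) (hl : 0 < B.coord l x) :
    HasAngle (tri B) x Real.pi := by
  obtain ⟨L, h1, h2, h3⟩ := exists_adapted_isometry B hkl hjk.symm hjl.symm
  have hvol : volume.real (Ici (0 : ℝ) ∩ Ioo (-Real.pi) Real.pi) = Real.pi := by
    have : Ici (0 : ℝ) ∩ Ioo (-Real.pi) Real.pi = Ico 0 Real.pi := by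
      ext φ; simp only [mem_inter_iff, mem_Ici, mem_Ioo, mem_Ico]
      constructor
      · rintro ⟨a, b, c⟩; exact ⟨a, c⟩
      · rintro ⟨a, c⟩; exact ⟨a, by linarith [Real.pi_pos], c⟩
    rw [this]; simp [Real.pi_pos.le]
  rw [← hvol]
  refine hasAngle_of_complex_sector L (A := {z | 0 ≤ z.im})
    (measurableSet_le measurable_const Complex.measurable_im) measurableSet_Ici ?_ ?_
  · intro t ht φ hφ
    simp only [mem_ofPred_eq, mem_Ici, Complex.mul_im, Complex.ofReal_re, Complex.add_im,
      Complex.ofReal_im, Complex.I_re, Complex.I_im, Complex.add_re, Complex.mul_re, mul_zero,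
      zero_mul, add_zero, mul_one, zero_add]
    rw [mul_nonneg_iff_of_pos_left ht]
    constructor
    · intro hs
      by_contra hn
      exact absurd hs (not_le.2 (Real.sin_neg_of_neg_of_neg_pi_lt (not_le.1 hn) hφ.1))
    · intro hs
      exact Real.sin_nonneg_of_nonneg_of_le_pi hs hφ.2.le
  · filter_upwards [(continuous_coord B k).continuousAt.eventually (lt_mem_nhds hk),
      (continuous_coord B l).continuousAt.eventually (lt_mem_nhds hl)] with y hyk hyl
    have : (L (y - x)).im = B.coord j y * (L (B j - B k)).im := by
      rw [sub_eq_coord_smul B hkl hjk.symm hjl.symm x y, map_add, L.map_smul, L.map_smul, h1, hj]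
      simp
    simp only [this, mul_nonneg_iff_of_pos_right h3, mem_tri_iff]
    constructor
    · intro h; exact h j
    · intro h i
      have : i ∈ (Finset.univ : Finset (Fin 3)) := Finset.mem_univ i
      rw [Fin.univ_three_eq hjk hjl hkl] at this
      simp only [Finset.mem_insert, Finset.mem_singleton] at this
      rcases this with rfl | rfl | rfl
      · exact h
      · exact hyk.le
      · exact hyl.le

theorem hasAngle_corner {j k l : Fin 3} (hjk : j ≠ k) (hjl : j ≠ l) (hkl : k ≠ l) :
    HasAngle (tri B) (B j) (EuclideanGeometry.angle (B k) (B j) (B l)) := by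
  obtain ⟨L, h1, h2, h3⟩ := exists_adapted_isometry B hjk hjl hkl
  set u := B k - B j
  set b := L (B l - B j) with hb
  have hu0 : u ≠ 0 := norm_pos_iff.1 h2
  have hb0 : b ≠ 0 := by rintro h; rw [h] at h3; simp at h3
  have hang : EuclideanGeometry.angle (B k) (B j) (B l) = b.arg := by
    rw [EuclideanGeometry.angle, vsub_eq_sub, vsub_eq_sub, ← L.toLinearIsometry.angle_map,
      InnerProductGeometry.angle_comm]
    change InnerProductGeometry.angle b (L u) = _
    rw [Complex.angle_eq_abs_arg hb0 (by simpa using hu0), h1, div_eq_mul_inv,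
      ← Complex.ofReal_inv, Complex.arg_mul_real (inv_pos.2 h2), abs_of_nonneg]
    exact Complex.arg_nonneg_iff.2 h3.le
  have hθ0 : 0 ≤ b.arg := Complex.arg_nonneg_iff.2 h3.le
  have hθπ : b.arg < Real.pi := Complex.arg_lt_pi_iff.2 (Or.inr h3.ne')
  have hbre : b.re = ‖b‖ * Real.cos b.arg := (Complex.norm_mul_cos_arg b).symm
  have hbim : b.im = ‖b‖ * Real.sin b.arg := (Complex.norm_mul_sin_arg b).symm
  have hbn : 0 < ‖b‖ := norm_pos_iff.2 hb0
  have hvol : volume.real (Icc (0 : ℝ) b.arg ∩ Ioo (-Real.pi) Real.pi) = b.arg := by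
    have : Icc (0 : ℝ) b.arg ∩ Ioo (-Real.pi) Real.pi = Icc 0 b.arg := by
      apply inter_eq_left.2
      rintro φ ⟨h, h'⟩
      exact ⟨by linarith [Real.pi_pos], by linarith⟩
    rw [this]; simp [hθ0]
  rw [hang]
  conv_rhs => rw [← hvol]
  refine hasAngle_of_complex_sector L
    (A := {z | 0 ≤ z.im ∧ 0 ≤ z.re * b.im - z.im * b.re}) ?_ measurableSet_Icc ?_ ?_
  · exact (measurableSet_le measurable_const Complex.measurable_im).inter
      (measurableSet_le measurable_const ((Complex.measurable_re.mul_const _).sub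
        (Complex.measurable_im.mul_const _)))
  · intro t ht φ hφ
    simp only [mem_ofPred_eq, Complex.mul_im, Complex.mul_re, Complex.ofReal_re, Complex.add_im,
      Complex.ofReal_im, Complex.I_re, Complex.I_im, Complex.add_re, mul_zero,
      zero_mul, add_zero, mul_one, zero_add, sub_zero, mem_Icc]
    have e : t * Real.cos φ * b.im - t * Real.sin φ * b.re
        = (t * ‖b‖) * Real.sin (b.arg - φ) := by
      rw [hbre, hbim, Real.sin_sub]; ring
    rw [e, mul_nonneg_iff_of_pos_left ht, mul_nonneg_iff_of_pos_left (by positivity)]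
    constructor
    · rintro ⟨hs, hs'⟩
      have h0 : 0 ≤ φ := by
        by_contra hn
        exact absurd hs (not_le.2 (Real.sin_neg_of_neg_of_neg_pi_lt (not_le.1 hn) hφ.1))
      refine ⟨h0, ?_⟩
      by_contra hn
      exact absurd hs' (not_le.2 (Real.sin_neg_of_neg_of_neg_pi_lt (by linarith)
        (by linarith [hφ.2])))
    · rintro ⟨hs, hs'⟩
      exact ⟨Real.sin_nonneg_of_nonneg_of_le_pi hs hφ.2.le,
        Real.sin_nonneg_of_nonneg_of_le_pi (by linarith) (by linarith)⟩
  · have hj : 0 < B.coord j (B j) := by simp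
    filter_upwards [(continuous_coord B j).continuousAt.eventually (lt_mem_nhds hj)] with y hyj
    have e : L (y - B j) = B.coord k y * (‖u‖ : ℂ) + B.coord l y * b := by
      rw [sub_eq_coord_smul B hjk hjl hkl (B j) y, map_add, L.map_smul, L.map_smul, h1, ← hb,
        B.coord_apply_ne hjk.symm, B.coord_apply_ne hjl.symm]
      simp
    have e1 : (L (y - B j)).im = B.coord l y * b.im := by rw [e]; simp
    have e2 : (L (y - B j)).re * b.im - (L (y - B j)).im * b.re
        = B.coord k y * (‖u‖ * b.im) := by rw [e]; simp; ring
    rw [e2, e1]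
    simp only [mul_nonneg_iff_of_pos_right h3,
      mul_nonneg_iff_of_pos_right (mul_pos h2 h3), mem_tri_iff]
    constructor
    · intro h; exact ⟨h l, h k⟩
    · intro h i
      have : i ∈ (Finset.univ : Finset (Fin 3)) := Finset.mem_univ i
      rw [Fin.univ_three_eq hjk hjl hkl] at this
      simp only [Finset.mem_insert, Finset.mem_singleton] at this
      rcases this with rfl | rfl | rfl
      · exact hyj.le
      · exact h.2
      · exact h.1

end

theorem Fin.ne_add_one (j : Fin 3) : j ≠ j + 1 := by revert j; decide
theorem Fin.ne_add_two (j : Fin 3) : j ≠ j + 2 := by revert j; decide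
theorem Fin.add_one_ne_add_two (j : Fin 3) : j + 1 ≠ j + 2 := by revert j; decide

/-- The angle at the vertex `B j`. -/
noncomputable def ang (B : AffineBasis (Fin 3) ℝ Plane) (j : Fin 3) : ℝ :=
  EuclideanGeometry.angle (B (j + 1)) (B j) (B (j + 2))

/-- The length of the side opposite to the vertex `B j`. -/
noncomputable def side (B : AffineBasis (Fin 3) ℝ Plane) (j : Fin 3) : ℝ :=
  dist (B (j + 1)) (B (j + 2))

section
variable (B : AffineBasis (Fin 3) ℝ Plane)

theorem eq_vertex_of_coord_eq_zero {j k l : Fin 3} (hjk : j ≠ k) (hjl : j ≠ l) (hkl : k ≠ l)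
    {x : Plane} (hk : B.coord k x = 0) (hl : B.coord l x = 0) : x = B j := by
  have := sub_eq_coord_smul B hjk hjl hkl (B j) x
  rw [hk, hl, B.coord_apply_ne hjk.symm, B.coord_apply_ne hjl.symm] at this
  simpa [sub_eq_zero] using this

theorem vertex_mem_tri (j : Fin 3) : B j ∈ tri B := subset_convexHull _ _ (mem_range_self j)

theorem exists_hasAngle (x : Plane) : ∃ θ, HasAngle (tri B) x θ ∧
    ((∃ j, x = B j ∧ θ = ang B j) ∨ ((∀ j, x ≠ B j) ∧
      ((x ∈ interior (tri B) ∧ θ = 2 * Real.pi) ∨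
        (x ∈ tri B ∧ x ∉ interior (tri B) ∧ θ = Real.pi) ∨ (x ∉ tri B ∧ θ = 0)))) := by
  by_cases hv : ∃ j, x = B j
  · obtain ⟨j, rfl⟩ := hv
    exact ⟨ang B j, hasAngle_corner B (Fin.ne_add_one j) (Fin.ne_add_two j)
      (Fin.add_one_ne_add_two j), Or.inl ⟨j, rfl, rfl⟩⟩
  push Not at hv
  by_cases hx : x ∈ tri B
  · by_cases hi : x ∈ interior (tri B)
    · exact ⟨_, HasAngle.of_mem_interior hi, Or.inr ⟨hv, Or.inl ⟨hi, rfl⟩⟩⟩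
    · refine ⟨_, ?_, Or.inr ⟨hv, Or.inr (Or.inl ⟨hx, hi, rfl⟩)⟩⟩
      have hx' := (mem_tri_iff B).1 hx
      obtain ⟨j, hj⟩ : ∃ j, B.coord j x = 0 := by
        by_contra! h
        exact hi ((mem_interior_tri_iff B).2 fun j => lt_of_le_of_ne (hx' j) (h j).symm)
      refine hasAngle_edge B (Fin.ne_add_one j) (Fin.ne_add_two j) (Fin.add_one_ne_add_two j) hj
        (lt_of_le_of_ne (hx' _) fun h => ?_) (lt_of_le_of_ne (hx' _) fun h => ?_)
      · exact hv _ (eq_vertex_of_coord_eq_zero B (Fin.ne_add_two j).symm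
          (Fin.add_one_ne_add_two j).symm (Fin.ne_add_one j) hj h.symm)
      · exact hv _ (eq_vertex_of_coord_eq_zero B (Fin.ne_add_one j).symm
          (Fin.add_one_ne_add_two j) (Fin.ne_add_two j) hj h.symm)
  · exact ⟨_, HasAngle.of_not_mem (isCompact_tri B).isClosed hx,
      Or.inr ⟨hv, Or.inr (Or.inr ⟨hx, rfl⟩)⟩⟩

theorem volume_tri_pos : 0 < volume (tri B) :=
  (Measure.measure_pos_of_nonempty_interior _ ⟨_, B.centroid_mem_interior_convexHull⟩)

end

/-! ### From reptilings to labelled triangle tilings -/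

/-- A dissection of the triangle `B` into the triangles `C i`, all similar to `B` with
ratio `ρ`. -/
structure IsTriangleTiling {r : ℕ} (B : AffineBasis (Fin 3) ℝ Plane)
    (C : Fin r → AffineBasis (Fin 3) ℝ Plane) (ρ : ℝ) : Prop where
  iUnion_eq : ⋃ i, tri (C i) = tri B
  disjoint_interior : ∀ i j, i ≠ j → Disjoint (interior (tri (C i))) (interior (tri (C j)))
  ang_eq : ∀ i j, ang (C i) j = ang B j
  side_eq : ∀ i j, side (C i) j = ρ * side B j
  pos : 0 < ρ
  mul_sq : r * ρ ^ 2 = 1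

theorem aedisjoint_tri {B C : AffineBasis (Fin 3) ℝ Plane}
    (h : Disjoint (interior (tri B)) (interior (tri C))) :
    AEDisjoint volume (tri B) (tri C) := by
  refine measure_mono_null (t := frontier (tri B) ∪ frontier (tri C)) ?_
    (measure_union_null ((convex_convexHull ℝ _).addHaar_frontier _)
      ((convex_convexHull ℝ _).addHaar_frontier _))
  rintro x ⟨hB, hC⟩
  by_cases hx : x ∈ interior (tri B)
  · exact Or.inr ⟨subset_closure hC, fun h' => disjoint_left.1 h hx h'⟩
  · exact Or.inl ⟨subset_closure hB, hx⟩

/-- Tiles overlap in null sets, since frontiers of convex sets are null; hence local areas, and with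
them angles, add up. -/
theorem hasAngle_sum {r : ℕ} {S : Set Plane} {C : Fin r → AffineBasis (Fin 3) ℝ Plane}
    (hU : ⋃ i, tri (C i) = S)
    (hd : ∀ i j, i ≠ j → Disjoint (interior (tri (C i))) (interior (tri (C j))))
    {x : Plane} {θ : Fin r → ℝ} (hθ : ∀ i, HasAngle (tri (C i)) x (θ i)) :
    HasAngle S x (∑ i, θ i) := by
  filter_upwards [eventually_all.2 hθ] with ε hε
  rw [← hU, iUnion_inter, measureReal_def, measure_iUnion₀, tsum_fintype, ENNReal.toReal_sum,
    Finset.sum_mul]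
  · exact Finset.sum_congr rfl fun i _ => hε i
  · exact fun i _ => ((measure_mono inter_subset_right).trans_lt measure_ball_lt_top).ne
  · exact fun i j hij => (aedisjoint_tri (hd i j hij)).mono inter_subset_left inter_subset_left
  · exact fun i => ((isCompact_tri (C i)).measurableSet.inter measurableSet_ball).nullMeasurableSet

/-- By Mazur–Ulam an isometry is affine, thus a linear isometry followed by a translation. -/
theorem volume_image_isometryEquiv (A : Plane ≃ᵢ Plane) (s : Set Plane) :
    volume (A '' s) = volume s := by
  let e := A.toRealAffineIsometryEquiv
  have he : ∀ y, A y = e.linearIsometryEquiv y + A 0 := fun y => by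
    have := e.map_vadd 0 y
    simpa [e] using this
  have : A '' s = (fun z => z + A 0) '' (e.linearIsometryEquiv '' s) := by
    rw [image_image]; exact image_congr fun y _ => he y
  rw [this, image_add_right, measure_preimage_add_right,
    LinearIsometryEquiv.image_eq_preimage_symm]
  exact e.linearIsometryEquiv.symm.measurePreserving.measure_preimage_equiv
    (f := e.linearIsometryEquiv.symm.toHomeomorph.toMeasurableEquiv) s

theorem DilationEquiv.exists_smul_isometryEquiv (f : Plane ≃ᵈ Plane) :
    ∃ ρ : ℝ, 0 < ρ ∧ ∃ A : Plane ≃ᵢ Plane, ∀ x, f x = ρ • A x := by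
  have h0 : (Dilation.ratio f : ℝ) ≠ 0 := by exact_mod_cast Dilation.ratio_ne_zero f
  set ρ : ℝ := (Dilation.ratio f : ℝ) with hρ
  refine ⟨ρ, lt_of_le_of_ne (NNReal.coe_nonneg _) h0.symm,
    IsometryEquiv.mk' (fun x => ρ⁻¹ • f x) (fun y => f.symm (ρ • y)) (fun y => ?_) ?_, fun x => ?_⟩
  · simp [inv_smul_smul₀ h0]
  · refine Isometry.of_dist_eq fun x y => ?_
    rw [dist_smul₀, Dilation.dist_eq, norm_inv, Real.norm_of_nonneg (NNReal.coe_nonneg _),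
      inv_mul_cancel_left₀ h0]
  · change f x = ρ • ρ⁻¹ • f x
    rw [smul_inv_smul₀ h0]

open scoped Pointwise in
/-- The image of a triangle under a similarity. -/
theorem exists_affineBasis_image (B : AffineBasis (Fin 3) ℝ Plane) {f : Plane → Plane} {ρ : ℝ}
    (hρ : 0 < ρ) (A : Plane ≃ᵢ Plane) (hf : ∀ x, f x = ρ • A x) :
    ∃ C : AffineBasis (Fin 3) ℝ Plane, tri C = f '' tri B ∧ (∀ j, ang C j = ang B j) ∧
      (∀ j, side C j = ρ * side B j) ∧
      volume (tri C) = ENNReal.ofReal (ρ ^ 2) * volume (tri B) := by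
  let e' := A.toRealAffineIsometryEquiv
  let e : Plane ≃ᵃ[ℝ] Plane := e'.toAffineEquiv.trans
    (LinearEquiv.smulOfNeZero ℝ Plane ρ hρ.ne').toAffineEquiv
  have hfe : f = e := by ext1 x; rw [hf]; simp [e, e']
  have hsub : ∀ x y, e x - e y = ρ • e'.linearIsometryEquiv (x - y) := fun x y => by
    rw [← hfe, hf, hf, ← smul_sub]
    congr 1
    have := e'.map_vsub x y
    simpa [e'] using this.symm
  have hind : AffineIndependent ℝ (e ∘ B) := e.affineIndependent_iff.2 B.ind
  refine ⟨⟨e ∘ B, hind, ?_⟩, ?_, fun j => ?_, fun j => ?_, ?_⟩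
  · rw [hind.affineSpan_eq_top_iff_card_eq_finrank_add_one]; simp
  · change convexHull ℝ (range (e ∘ B)) = _
    rw [range_comp, hfe]
    exact (e.toAffineMap.image_convexHull _).symm
  · change InnerProductGeometry.angle (e (B (j + 1)) -ᵥ e (B j)) (e (B (j + 2)) -ᵥ e (B j)) = _
    rw [vsub_eq_sub, vsub_eq_sub, hsub, hsub, InnerProductGeometry.angle_smul_smul hρ.ne']
    exact e'.linearIsometryEquiv.toLinearIsometry.angle_map _ _
  · change dist (e (B (j + 1))) (e (B (j + 2))) = _
    rw [dist_eq_norm, hsub, norm_smul, LinearIsometryEquiv.norm_map, ← dist_eq_norm,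
      Real.norm_of_nonneg hρ.le]
    rfl
  · have : convexHull ℝ (range (e ∘ B)) = ρ • (A '' tri B) := by
      rw [range_comp, ← image_smul, image_image]
      refine ((e.toAffineMap.image_convexHull _).symm.trans ?_)
      refine image_congr fun x _ => ?_
      rw [← hf, hfe]; rfl
    change volume (convexHull ℝ (range (e ∘ B))) = _
    rw [this, Measure.addHaar_smul, volume_image_isometryEquiv]
    simp

/-- Congruent tiles have equal areas, hence equal similarity ratios ρ, and adding the areas gives
rρ² = 1. -/
theorem IsReptiling.exists_isTriangleTiling {r : ℕ} {S : Set Plane} {tile : Fin r → Set Plane}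
    (h : IsReptiling S tile) (B : AffineBasis (Fin 3) ℝ Plane) (hS : tri B = S) :
    ∃ (C : Fin r → AffineBasis (Fin 3) ℝ Plane) (ρ : ℝ), IsTriangleTiling B C ρ ∧
      ∀ i, tile i = tri (C i) := by
  have hex : ∀ i, ∃ ρ : ℝ, 0 < ρ ∧ ∃ C : AffineBasis (Fin 3) ℝ Plane, tri C = tile i ∧
      (∀ j, ang C j = ang B j) ∧ (∀ j, side C j = ρ * side B j) ∧
      volume (tri C) = ENNReal.ofReal (ρ ^ 2) * volume (tri B) := fun i => by
    obtain ⟨f, hf⟩ := h.similar i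
    obtain ⟨ρ, hρ, A, hA⟩ := f.exists_smul_isometryEquiv
    obtain ⟨C, h1, h2⟩ := exists_affineBasis_image B hρ A hA
    exact ⟨ρ, hρ, C, by rw [h1, hS, hf], h2⟩
  choose ρ hρ C hC hang hside hvol using hex
  have hB0 := (volume_tri_pos B).ne'
  have hBt : volume (tri B) ≠ ⊤ := (isCompact_tri B).measure_lt_top.ne
  have hρeq : ∀ i j, ρ i = ρ j := fun i j => by
    obtain ⟨g, hg⟩ := h.congruent i j
    have := volume_image_isometryEquiv g (tile i)
    rw [hg, ← hC i, ← hC j, hvol, hvol] at this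
    have := (ENNReal.mul_left_inj hB0 hBt).1 this
    rw [ENNReal.ofReal_eq_ofReal_iff (by positivity) (by positivity),
      sq_eq_sq₀ (hρ j).le (hρ i).le] at this
    exact this.symm
  have hr : 0 < r := lt_of_lt_of_le two_pos h.two_le
  let i₀ : Fin r := ⟨0, hr⟩
  have hU : ⋃ i, tri (C i) = tri B := by
    rw [hS, ← h.iUnion_eq]; exact iUnion_congr hC
  have hd : ∀ i j, i ≠ j → Disjoint (interior (tri (C i))) (interior (tri (C j))) := by
    intro i j hij
    rw [hC, hC]; exact h.disjoint_interior i j hij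
  refine ⟨C, ρ i₀, ⟨hU, hd, hang, fun i j => ?_, hρ i₀, ?_⟩, fun i => (hC i).symm⟩
  · rw [hside, hρeq i i₀]
  · have hm : volume (tri B) = r * (ENNReal.ofReal (ρ i₀ ^ 2) * volume (tri B)) := by
      conv_lhs => rw [← hU, measure_iUnion₀ (fun i j hij => aedisjoint_tri (hd i j hij))
        (fun i => (isCompact_tri (C i)).measurableSet.nullMeasurableSet), tsum_fintype]
      rw [Finset.sum_congr rfl fun i _ => (hvol i).trans (by rw [hρeq i i₀])]
      simp
    have := congrArg ENNReal.toReal hm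
    simp only [ENNReal.toReal_mul, ENNReal.toReal_natCast,
      ENNReal.toReal_ofReal (sq_nonneg (ρ i₀))] at this
    have hpos : 0 < (volume (tri B)).toReal := ENNReal.toReal_pos hB0 hBt
    have : (r * ρ i₀ ^ 2 - 1) * (volume (tri B)).toReal = 0 := by linarith
    rcases mul_eq_zero.1 this with h | h <;> linarith

/-! ### Counting tile corners at a point -/

section
variable (B : AffineBasis (Fin 3) ℝ Plane)

theorem sum_ang : ∑ j, ang B j = Real.pi := by
  have := EuclideanGeometry.angle_add_angle_add_angle_eq_pi (p₁ := B 0) (p₂ := B 1) (B 2)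
    (B.ind.injective.ne (by decide))
  rw [Fin.sum_univ_three]
  simp only [ang]
  have e1 : (1 : Fin 3) + 1 = 2 := rfl
  have e2 : (1 : Fin 3) + 2 = 0 := rfl
  have e3 : (2 : Fin 3) + 1 = 0 := rfl
  have e4 : (2 : Fin 3) + 2 = 1 := rfl
  rw [zero_add, zero_add, e1, e2, e3, e4, EuclideanGeometry.angle_comm (B 1) (B 0),
    EuclideanGeometry.angle_comm (B 2) (B 1), EuclideanGeometry.angle_comm (B 0) (B 2)]
  linarith

variable {B}

theorem ang_pos_of_acute (hB : ∀ j, ang B j < Real.pi / 2) (j : Fin 3) : 0 < ang B j := by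
  have := sum_ang B
  rw [Fin.sum_three_of_ne (Fin.ne_add_one j) (Fin.ne_add_two j) (Fin.add_one_ne_add_two j)] at this
  linarith [hB (j + 1), hB (j + 2)]

end

open Classical in
/-- The number of triangles whose vertex number `j` is the point `x`. -/
noncomputable def cornerCount {r : ℕ} (C : Fin r → AffineBasis (Fin 3) ℝ Plane) (x : Plane)
    (j : Fin 3) : ℕ :=
  (Finset.univ.filter fun i => C i j = x).card

namespace IsTriangleTiling

variable {r : ℕ} {B : AffineBasis (Fin 3) ℝ Plane} {C : Fin r → AffineBasis (Fin 3) ℝ Plane}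
  {ρ : ℝ}

theorem tri_subset (h : IsTriangleTiling B C ρ) (i : Fin r) : tri (C i) ⊆ tri B := by
  rw [← h.iUnion_eq]; exact subset_iUnion (fun i => tri (C i)) i

/-- A tile without a corner at x contributes 0, π or 2π there, according as x is outside, on a side
or in the interior; m records the multiple of π. -/
theorem exists_angle_sum_eq (h : IsTriangleTiling B C ρ) {x : Plane} {θ : ℝ}
    (hθ : HasAngle (tri B) x θ) :
    ∃ m : Fin r → ℕ, (∑ j, cornerCount C x j * ang B j) + (∑ i, m i : ℕ) * Real.pi = θ ∧
      ∀ i, x ∈ tri (C i) → (∃ j, C i j = x) ∨ 1 ≤ m i := by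
  classical
  choose τ hτ hcase using fun i => exists_hasAngle (C i) x
  have hm : ∀ i, ∃ m : ℕ, τ i = (∑ j, if C i j = x then ang B j else 0) + m * Real.pi ∧
      (x ∈ tri (C i) → (∃ j, C i j = x) ∨ 1 ≤ m) := fun i => by
    rcases hcase i with ⟨j, hx, hj⟩ | ⟨hv, hc⟩
    · refine ⟨0, ?_, fun _ => Or.inl ⟨j, hx.symm⟩⟩
      rw [Finset.sum_eq_single j, if_pos hx.symm, hj, h.ang_eq]
      · simp
      · intro j' _ hne
        rw [if_neg]
        rw [hx]; exact (C i).ind.injective.ne hne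
      · simp
    · have h0 : (∑ j, if C i j = x then ang B j else 0) = 0 :=
        Finset.sum_eq_zero fun j _ => if_neg (hv j).symm
      rw [h0]
      rcases hc with ⟨_, h1⟩ | ⟨_, _, h1⟩ | ⟨h2, h1⟩
      · exact ⟨2, by rw [h1]; push_cast; ring, fun _ => Or.inr (by norm_num)⟩
      · exact ⟨1, by rw [h1]; push_cast; ring, fun _ => Or.inr le_rfl⟩
      · exact ⟨0, by rw [h1]; push_cast; ring, fun h => absurd h h2⟩
  choose m hm1 hm2 using hm
  refine ⟨m, ?_, hm2⟩
  rw [hθ.unique (hasAngle_sum h.iUnion_eq h.disjoint_interior hτ), Finset.sum_congr rfl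
    fun i _ => hm1 i, Finset.sum_add_distrib, Finset.sum_comm, ← Finset.sum_mul]
  push_cast
  congr 1
  refine Finset.sum_congr rfl fun j _ => ?_
  rw [← Finset.sum_filter, Finset.sum_const, nsmul_eq_mul, cornerCount]

theorem sum_cornerCount_vertex (h : IsTriangleTiling B C ρ) (hB : ∀ j, ang B j < Real.pi / 2)
    (v : Fin 3) : (∑ j, cornerCount C (B v) j * ang B j) = ang B v ∧
      ∀ i, B v ∈ tri (C i) → ∃ j, C i j = B v := by
  obtain ⟨m, hm, hmi⟩ := h.exists_angle_sum_eq (hasAngle_corner B (Fin.ne_add_one v)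
    (Fin.ne_add_two v) (Fin.add_one_ne_add_two v))
  change _ = ang B v at hm
  have hpos : 0 ≤ ∑ j, cornerCount C (B v) j * ang B j :=
    Finset.sum_nonneg fun j _ => mul_nonneg (Nat.cast_nonneg _) (ang_pos_of_acute hB j).le
  have h0 : (∑ i, m i) = 0 := by
    by_contra hne
    have : (1 : ℝ) ≤ (∑ i, m i : ℕ) := by exact_mod_cast Nat.one_le_iff_ne_zero.2 hne
    nlinarith [hB v, Real.pi_pos]
  refine ⟨by rw [h0] at hm; simpa using hm, fun i hi => ?_⟩
  refine (hmi i hi).resolve_right ?_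
  have := Finset.sum_eq_zero_iff.1 h0 i (Finset.mem_univ i)
  omega

theorem sum_cornerCount_of_ne_vertex (h : IsTriangleTiling B C ρ)
    (hB : ∀ j, ang B j < Real.pi / 2) {i₀ : Fin r} {j₀ : Fin 3} (hx : ∀ v, C i₀ j₀ ≠ B v) :
    (∑ j, cornerCount C (C i₀ j₀) j * ang B j) = Real.pi ∨
      (∑ j, cornerCount C (C i₀ j₀) j * ang B j) = 2 * Real.pi := by
  classical
  obtain ⟨θ, hθ, hc⟩ := exists_hasAngle B (C i₀ j₀)
  obtain ⟨m, hm, -⟩ := h.exists_angle_sum_eq hθ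
  have hpos : 0 < ∑ j, cornerCount C (C i₀ j₀) j * ang B j := by
    refine Finset.sum_pos' (fun j _ => mul_nonneg (Nat.cast_nonneg _) (ang_pos_of_acute hB j).le)
      ⟨j₀, Finset.mem_univ _, mul_pos ?_ (ang_pos_of_acute hB j₀)⟩
    rw [Nat.cast_pos, cornerCount, Finset.card_pos]
    exact ⟨i₀, by simp⟩
  have hmem : C i₀ j₀ ∈ tri B := h.tri_subset i₀ (vertex_mem_tri _ _)
  set S := ∑ j, cornerCount C (C i₀ j₀) j * ang B j
  set M := ∑ i, m i
  have hlt : ∀ n : ℕ, θ = n * Real.pi → M < n := fun n hn => by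
    have : (M : ℝ) * Real.pi < n * Real.pi := by linarith
    exact_mod_cast lt_of_mul_lt_mul_right this Real.pi_pos.le
  rcases hc with ⟨v, hv, -⟩ | ⟨-, ⟨_, h1⟩ | ⟨_, _, h1⟩ | ⟨h2, -⟩⟩
  · exact absurd hv (hx v)
  · have := hlt 2 (by rw [h1]; norm_num)
    interval_cases hM : M
    · right; push_cast at hm; linarith
    · left; push_cast at hm; linarith
  · have := hlt 1 (by rw [h1]; norm_num)
    interval_cases hM : M
    left; push_cast at hm; linarith
  · exact absurd hmem h2

theorem sum_cornerCount_eq_ncard (h : IsTriangleTiling B C ρ) (hB : ∀ j, ang B j < Real.pi / 2)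
    (v : Fin 3) : ∑ j, cornerCount C (B v) j = {i | B v ∈ tri (C i)}.ncard := by
  classical
  have hset : {i | B v ∈ tri (C i)} =
      ((Finset.univ.biUnion fun j => Finset.univ.filter fun i => C i j = B v : Finset (Fin r)) :
        Set (Fin r)) := by
    ext i
    simp only [Finset.coe_biUnion, mem_iUnion, Finset.coe_filter, Finset.mem_univ, true_and,
      mem_ofPred_eq, Finset.mem_coe, exists_prop]
    constructor
    · intro hi
      obtain ⟨j, hj⟩ := (h.sum_cornerCount_vertex hB v).2 i hi
      exact ⟨j, hj⟩
    · rintro ⟨j, hj⟩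
      rw [← hj]; exact vertex_mem_tri _ _
  rw [hset, Set.ncard_coe_finset, Finset.card_biUnion]
  · rfl
  · intro j _ j' _ hjj
    refine Finset.disjoint_left.2 fun i hi hi' => hjj ?_
    simp only [Finset.mem_filter, Finset.mem_univ, true_and] at hi hi'
    exact (C i).ind.injective (hi.trans hi'.symm)

/-- A corner equal to the angle at v would fill that angle alone, against k ≥ 2. One corner of each
of the other two angles would make their sum at most the angle at v, hence the angle sum of B less
than π. -/
theorem exists_split_angle (h : IsTriangleTiling B C ρ) (hB : ∀ j, ang B j < Real.pi / 2)
    {v : Fin 3} {k : ℕ} (hk : 2 ≤ k) (hv : {i | B v ∈ tri (C i)}.ncard = k) :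
    ∃ u t : Fin 3, u ≠ t ∧ u ≠ v ∧ t ≠ v ∧ cornerCount C (B v) u = k ∧
      cornerCount C (B v) t = 0 ∧ cornerCount C (B v) v = 0 := by
  have key : ∀ u t : Fin 3, u ≠ t → u ≠ v → t ≠ v → cornerCount C (B v) t = 0 →
      cornerCount C (B v) v = 0 → cornerCount C (B v) u = k := by
    intro u t hut huv htv h1 h2
    have := h.sum_cornerCount_eq_ncard hB v
    rw [Fin.sum_three_of_ne hut huv htv, h1, h2, hv] at this
    simpa using this
  have hsum := (h.sum_cornerCount_vertex hB v).1
  have hcard := h.sum_cornerCount_eq_ncard hB v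
  have hpi := sum_ang B
  have n1 := Fin.ne_add_one v
  have n2 := Fin.ne_add_two v
  have n3 := Fin.add_one_ne_add_two v
  rw [Fin.sum_three_of_ne n1 n2 n3] at hsum hcard hpi
  rw [hv] at hcard
  have p0 := ang_pos_of_acute hB v
  have p1 := ang_pos_of_acute hB (v + 1)
  have p2 := ang_pos_of_acute hB (v + 2)
  have q0 := hB v
  set a := cornerCount C (B v) v with ha
  set b := cornerCount C (B v) (v + 1) with hb
  set c := cornerCount C (B v) (v + 2) with hc
  have hmul : ∀ (n : ℕ) (x : ℝ), 0 < x → n ≠ 0 → x ≤ n * x := fun n x hx hn => by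
    have : (1 : ℝ) ≤ n := by exact_mod_cast Nat.one_le_iff_ne_zero.2 hn
    nlinarith
  have hnn : ∀ (n : ℕ) (x : ℝ), 0 < x → 0 ≤ n * x := fun n x hx => by positivity
  have ha0 : a = 0 := by
    by_contra hne
    have h1 := hmul a _ p0 hne
    have hb0 : b = 0 := by
      by_contra hne'
      linarith [hmul b _ p1 hne', hnn c _ p2]
    have hc0 : c = 0 := by
      by_contra hne'
      linarith [hmul c _ p2 hne', hnn b _ p1]
    have ha2 : (2 : ℝ) ≤ a := by exact_mod_cast (by omega : 2 ≤ a)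
    rw [hb0, hc0] at hsum
    push_cast at hsum
    nlinarith
  by_cases hb0 : b = 0
  · exact ⟨v + 2, v + 1, n3.symm, n2.symm, n1.symm, key _ _ n3.symm n2.symm n1.symm hb0 ha0,
      hb0, ha0⟩
  by_cases hc0 : c = 0
  · exact ⟨v + 1, v + 2, n3, n1.symm, n2.symm, key _ _ n3 n1.symm n2.symm hc0 ha0, hc0, ha0⟩
  · exfalso
    linarith [hmul b _ p1 hb0, hmul c _ p2 hc0, hnn a _ p0]

theorem false_of_weights (h : IsTriangleTiling B C ρ) (hB : ∀ j, ang B j < Real.pi / 2)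
    {u v : Fin 3} (huv : u ≠ v) {k : ℕ} (hk : cornerCount C (B v) u = k)
    (hmin : ∀ j, j ≠ u → ang B u < ang B j) {w : Fin 3 → ℤ} (hw : ∑ j, w j = 0)
    (hw0 : ∀ n : Fin 3 → ℕ, ∑ j, n j * ang B j = Real.pi ∨ ∑ j, n j * ang B j = 2 * Real.pi →
      0 ≤ ∑ j, w j * n j)
    (hw1 : ∀ n : Fin 3 → ℕ, ∑ j, n j * ang B j = Real.pi → k + 1 ≤ n u → 0 < ∑ j, w j * n j) :
    False := by
  classical
  -- All corners at the three vertices of B taken together.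
  let N : Fin 3 → ℕ := fun j => ∑ s, cornerCount C (B s) j
  have hN : ∑ j, N j * ang B j = Real.pi := by
    rw [← sum_ang B]
    simp only [N, Nat.cast_sum, Finset.sum_mul]
    rw [Finset.sum_comm]
    exact Finset.sum_congr rfl fun s _ => (h.sum_cornerCount_vertex hB s).1
  -- The smallest angle can only be filled by itself; this supplies the extra +1 beyond the k copies
  -- at B v.
  have hu1 : 1 ≤ cornerCount C (B u) u := by
    by_contra hlt
    have h0 : cornerCount C (B u) u = 0 := by omega
    have hs := (h.sum_cornerCount_vertex hB u).1
    have hz : ∀ j, cornerCount C (B u) j = 0 := fun j => by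
      by_contra hne
      have hj : j ≠ u := by rintro rfl; exact hne h0
      have h1 : (1 : ℝ) ≤ cornerCount C (B u) j := by
        exact_mod_cast Nat.one_le_iff_ne_zero.2 hne
      have h2 := Finset.single_le_sum (f := fun j => (cornerCount C (B u) j : ℝ) * ang B j)
        (fun j _ => mul_nonneg (Nat.cast_nonneg _) (ang_pos_of_acute hB j).le)
        (Finset.mem_univ j)
      rw [hs] at h2
      nlinarith [hmin j hj, ang_pos_of_acute hB j]
    rw [Finset.sum_eq_zero (fun j _ => by rw [hz j]; simp)] at hs
    exact (ang_pos_of_acute hB u).ne hs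
  have hNu : k + 1 ≤ N u := by
    have : ∑ s ∈ {v, u}, cornerCount C (B s) u ≤ N u :=
      Finset.sum_le_sum_of_subset (Finset.subset_univ _)
    rw [Finset.sum_pair huv.symm] at this
    omega
  let W : Finset Plane := (Finset.univ.image fun p : Fin r × Fin 3 => C p.1 p.2) ∪
    Finset.univ.image B
  -- Each tile has exactly one corner number j.
  have htot : ∀ j, ∑ x ∈ W, cornerCount C x j = r := fun j => by
    have := Finset.card_eq_sum_card_fiberwise (s := (Finset.univ : Finset (Fin r))) (t := W)
      (f := fun i => C i j) (fun i _ => Finset.mem_coe.2 (Finset.mem_union_left _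
        (Finset.mem_image.2 ⟨(i, j), Finset.mem_univ _, rfl⟩)))
    rw [Finset.card_univ, Fintype.card_fin] at this
    exact this.symm
  have hsplit : ∀ j, (∑ x ∈ W \ Finset.univ.image B, cornerCount C x j) + N j = r := fun j => by
    have h1 := Finset.sum_sdiff (f := fun x => cornerCount C x j)
      (Finset.subset_union_right : Finset.univ.image B ⊆ W)
    rwa [htot j, Finset.sum_image (fun a _ b _ hab => B.ind.injective hab)] at h1
  have hpos := hw1 N hN hNu
  have hnonneg : 0 ≤ ∑ x ∈ W \ Finset.univ.image B, ∑ j, w j * cornerCount C x j := by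
    refine Finset.sum_nonneg fun x hx => hw0 _ ?_
    rw [Finset.mem_sdiff, Finset.mem_union] at hx
    obtain ⟨⟨i, j⟩, -, rfl⟩ := Finset.mem_image.1 (hx.1.resolve_right hx.2)
    exact h.sum_cornerCount_of_ne_vertex hB fun s hs =>
      hx.2 (Finset.mem_image.2 ⟨s, Finset.mem_univ _, hs.symm⟩)
  rw [Finset.sum_comm] at hnonneg
  have hzero : (∑ j, ∑ x ∈ W \ Finset.univ.image B, w j * (cornerCount C x j : ℤ))
      + ∑ j, w j * N j = 0 := by
    rw [← Finset.sum_add_distrib]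
    calc _ = ∑ j, w j * (r : ℤ) := by
          refine Finset.sum_congr rfl fun j _ => ?_
          have : (r : ℤ) = ((∑ x ∈ W \ Finset.univ.image B, cornerCount C x j) + N j : ℕ) := by
            rw [hsplit j]
          rw [this, ← Finset.mul_sum]; push_cast; ring
      _ = 0 := by rw [← Finset.sum_mul, hw, zero_mul]
  linarith

end IsTriangleTiling

/-! ### Tile sides along the sides of the large triangle -/

theorem Fin.eq_add_one_or_eq_add_two {b m : Fin 3} (h : b ≠ m) : m = b + 1 ∨ m = b + 2 := by
  revert b m; decide

/-- The side of the triangle `B` opposite to the vertex `B j`. -/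
abbrev edge (B : AffineBasis (Fin 3) ℝ Plane) (j : Fin 3) : Set Plane :=
  segment ℝ (B (j + 1)) (B (j + 2))

section
variable (B : AffineBasis (Fin 3) ℝ Plane)

theorem edge_subset_tri (j : Fin 3) : edge B j ⊆ tri B :=
  (convex_convexHull ℝ _).segment_subset (vertex_mem_tri B _) (vertex_mem_tri B _)

theorem isCompact_edge (j : Fin 3) : IsCompact (edge B j) := by
  rw [edge, segment_eq_image_lineMap]
  exact isCompact_Icc.image AffineMap.lineMap_continuous

theorem mem_edge_iff {j : Fin 3} {x : Plane} (hx : x ∈ tri B) :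
    x ∈ edge B j ↔ B.coord j x = 0 := by
  constructor
  · intro h
    rw [edge, segment_eq_image_lineMap] at h
    obtain ⟨t, -, rfl⟩ := h
    rw [AffineMap.apply_lineMap, B.coord_apply_ne (Fin.ne_add_one j),
      B.coord_apply_ne (Fin.ne_add_two j)]
    simp
  · intro h
    have hx' := (mem_tri_iff B).1 hx
    have hs := B.sum_coord_apply_eq_one x
    rw [Fin.sum_three_of_ne (Fin.ne_add_one j) (Fin.ne_add_two j) (Fin.add_one_ne_add_two j), h]
      at hs
    have e := sub_eq_coord_smul B (Fin.ne_add_one j).symm (Fin.add_one_ne_add_two j)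
      (Fin.ne_add_two j) (B (j + 1)) x
    rw [h, B.coord_apply_ne (Fin.ne_add_one j), B.coord_apply_ne (Fin.add_one_ne_add_two j).symm]
      at e
    rw [edge, segment_eq_image_lineMap]
    refine ⟨B.coord (j + 2) x, ⟨hx' _, by linarith [hx' (j + 1)]⟩, ?_⟩
    rw [AffineMap.lineMap_apply, vsub_eq_sub, vadd_eq_add]
    rw [sub_self, zero_smul, zero_add, sub_zero] at e
    rw [← e]; abel

theorem coord_eq_sum (C : AffineBasis (Fin 3) ℝ Plane) (j : Fin 3) (x : Plane) :
    B.coord j x = ∑ m, C.coord m x * B.coord j (C m) := by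
  have h := congrArg (B.coord j) (C.affineCombination_coord_eq_self x)
  rw [Finset.map_affineCombination _ _ _ (C.sum_coord_apply_eq_one x),
    Finset.affineCombination_eq_linear_combination _ _ _ (C.sum_coord_apply_eq_one x)] at h
  rw [← h]
  simp

/-- Coordinate j of B is nonnegative on C, so a point of C where it vanishes is a combination of
vertices of C where it vanishes: the intersection is a proper face of C. -/
theorem edge_inter_tri {C : AffineBasis (Fin 3) ℝ Plane} (hC : tri C ⊆ tri B) (j : Fin 3) :
    (∃ m, C m ∉ edge B j ∧ C (m + 1) ∈ edge B j ∧ C (m + 2) ∈ edge B j ∧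
      edge B j ∩ tri C = edge C m) ∨
    ((∀ m, ¬ (C (m + 1) ∈ edge B j ∧ C (m + 2) ∈ edge B j)) ∧
      edge B j ∩ tri C ⊆ range C) := by
  have hmem : ∀ m, C m ∈ edge B j ↔ B.coord j (C m) = 0 := fun m =>
    mem_edge_iff B (hC (vertex_mem_tri C m))
  have hnn : ∀ m, 0 ≤ B.coord j (C m) := fun m =>
    (mem_tri_iff B).1 (hC (vertex_mem_tri C m)) j
  have hzero : ∀ x ∈ edge B j ∩ tri C, ∀ m, C m ∉ edge B j → C.coord m x = 0 := by
    rintro x ⟨hx, hxC⟩ m hm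
    have h0 := (mem_edge_iff B (hC hxC)).1 hx
    rw [coord_eq_sum B C, Finset.sum_eq_zero_iff_of_nonneg
      (fun m _ => mul_nonneg ((mem_tri_iff C).1 hxC m) (hnn m))] at h0
    exact (mul_eq_zero.1 (h0 m (Finset.mem_univ m))).resolve_right fun h => hm ((hmem m).2 h)
  by_cases hm : ∃ m, C (m + 1) ∈ edge B j ∧ C (m + 2) ∈ edge B j
  · obtain ⟨m, h1, h2⟩ := hm
    have h0 : C m ∉ edge B j := fun h0 => by
      have h := coord_eq_sum B C j (B j)
      rw [B.coord_apply_eq, Fin.sum_three_of_ne (Fin.ne_add_one m) (Fin.ne_add_two m)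
        (Fin.add_one_ne_add_two m), (hmem _).1 h0, (hmem _).1 h1, (hmem _).1 h2] at h
      norm_num at h
    refine Or.inl ⟨m, h0, h1, h2, Subset.antisymm ?_ ?_⟩
    · intro x hx
      exact (mem_edge_iff C hx.2).2 (hzero x hx m h0)
    · exact fun x hx => ⟨(convex_segment _ _).segment_subset h1 h2 hx, edge_subset_tri C m hx⟩
  · push Not at hm
    refine Or.inr ⟨fun m h => hm m h.1 h.2, fun x hx => ?_⟩
    have h3 : ∃ m, C (m + 1) ∉ edge B j ∧ C (m + 2) ∉ edge B j := by
      by_cases a0 : C 0 ∈ edge B j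
      · exact ⟨0, hm 2 a0, fun h => hm 1 h a0⟩
      · by_cases a1 : C 1 ∈ edge B j
        · exact ⟨1, hm 0 a1, a0⟩
        · exact ⟨2, a0, a1⟩
    obtain ⟨m, h1, h2⟩ := h3
    exact ⟨m, (eq_vertex_of_coord_eq_zero C (Fin.ne_add_one m) (Fin.ne_add_two m)
      (Fin.add_one_ne_add_two m) (hzero x hx _ h1) (hzero x hx _ h2)).symm⟩

theorem sin_ang_mul_side (j k : Fin 3) :
    Real.sin (ang B j) * side B k = Real.sin (ang B k) * side B j := by
  have key : ∀ j, Real.sin (ang B j) * side B (j + 1) = Real.sin (ang B (j + 1)) * side B j := by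
    intro j
    have e1 : j + 1 + 1 = j + 2 := by revert j; decide
    have e2 : j + 1 + 2 = j := by revert j; decide
    have := EuclideanGeometry.law_sin (B (j + 1)) (B j) (B (j + 2))
    simp only [ang, side, e1, e2]
    rw [dist_comm (B (j + 2)) (B j), this, dist_comm (B (j + 2)), EuclideanGeometry.angle_comm]
  have h0 := key 0
  have h1 := key 1
  have h2 := key 2
  norm_num at h0 h1 h2
  change _ = Real.sin (ang B 2) * _ at h1
  change Real.sin (ang B 2) * side B 0 = Real.sin (ang B 0) * side B 2 at h2
  change Real.sin (ang B 1) * side B 2 = _ at h1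
  fin_cases j <;> fin_cases k <;> simp only [Fin.zero_eta, Fin.mk_one, Fin.reduceFinMk] <;>
    linarith

theorem side_pos (j : Fin 3) : 0 < side B j :=
  dist_pos.2 (B.ind.injective.ne (Fin.add_one_ne_add_two j))

end

namespace IsTriangleTiling

variable {r : ℕ} {B : AffineBasis (Fin 3) ℝ Plane} {C : Fin r → AffineBasis (Fin 3) ℝ Plane}
  {ρ : ℝ}

open Classical in
/-- The number of tiles whose side number `m` lies on the side number `j` of `B`. -/
noncomputable def edgeCount (B : AffineBasis (Fin 3) ℝ Plane)
    (C : Fin r → AffineBasis (Fin 3) ℝ Plane) (j m : Fin 3) : ℕ :=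
  (Finset.univ.filter fun i => C i (m + 1) ∈ edge B j ∧ C i (m + 2) ∈ edge B j).card

/-- The local angle of B at x is π, and each tile containing x already contributes at least π. -/
theorem subsingleton_tile_of_mem_edge (h : IsTriangleTiling B C ρ) {j : Fin 3} {x : Plane}
    (hx : x ∈ edge B j) (hxB : ∀ v, x ≠ B v) (hxC : ∀ i m, x ≠ C i m) {i i' : Fin r}
    (hi : x ∈ tri (C i)) (hi' : x ∈ tri (C i')) : i = i' := by
  classical
  by_contra hne
  have hxt := edge_subset_tri B j hx
  have h0 := (mem_edge_iff B hxt).1 hx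
  obtain ⟨θ, hθ, hc⟩ := exists_hasAngle B x
  have hθπ : θ = Real.pi := by
    rcases hc with ⟨v, hv, -⟩ | ⟨-, ⟨h1, -⟩ | ⟨_, _, h1⟩ | ⟨h1, -⟩⟩
    · exact absurd hv (hxB v)
    · exact absurd ((mem_interior_tri_iff B).1 h1 j) (by rw [h0]; exact lt_irrefl _)
    · exact h1
    · exact absurd hxt h1
  obtain ⟨m, hm, hmi⟩ := h.exists_angle_sum_eq hθ
  have hz : ∀ j, cornerCount C x j = 0 := fun j => by
    rw [cornerCount, Finset.card_eq_zero, Finset.filter_eq_empty_iff]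
    exact fun i _ hij => hxC i j hij.symm
  rw [Finset.sum_eq_zero (fun j _ => by rw [hz j]; simp), zero_add, hθπ] at hm
  have h1 : (((∑ i, m i : ℕ) : ℝ) - 1) * Real.pi = 0 := by linarith
  have h2 : (∑ i, m i) = 1 := by
    have := (mul_eq_zero.1 h1).resolve_right Real.pi_pos.ne'
    exact_mod_cast sub_eq_zero.1 this
  have h3 : ∑ s ∈ {i, i'}, m s ≤ ∑ s, m s := Finset.sum_le_sum_of_subset (Finset.subset_univ _)
  rw [Finset.sum_pair hne] at h3
  have := (hmi i hi).resolve_left fun ⟨j, hj⟩ => hxC i j hj.symm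
  have := (hmi i' hi').resolve_left fun ⟨j, hj⟩ => hxC i' j hj.symm
  omega

theorem edge_eq_iUnion (h : IsTriangleTiling B C ρ) (j : Fin 3) :
    edge B j = ⋃ i, edge B j ∩ tri (C i) := by
  rw [← inter_iUnion, h.iUnion_eq, inter_eq_left.2 (edge_subset_tri B j)]

open Classical in
theorem hausdorffMeasure_edge_inter (h : IsTriangleTiling B C ρ) (i : Fin r) (j : Fin 3) :
    μH[1] (edge B j ∩ tri (C i)) = ENNReal.ofReal (∑ m, if C i (m + 1) ∈ edge B j ∧
      C i (m + 2) ∈ edge B j then ρ * side B m else 0) := by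
  rcases edge_inter_tri B (h.tri_subset i) j with ⟨m, h0, h1, h2, he⟩ | ⟨hm, hsub⟩
  · rw [he, hausdorffMeasure_segment, edist_dist]
    congr 1
    rw [Finset.sum_eq_single m, if_pos ⟨h1, h2⟩, ← h.side_eq i]
    · rfl
    · intro b _ hb
      rw [if_neg]
      rintro ⟨h3, h4⟩
      have : m = b + 1 ∨ m = b + 2 := Fin.eq_add_one_or_eq_add_two hb
      rcases this with rfl | rfl
      · exact h0 h3
      · exact h0 h4
    · simp
  · rw [Finset.sum_eq_zero fun m _ => if_neg (hm m), ENNReal.ofReal_zero]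
    have : NullSingletonClass (μH[1] : Measure Plane) := Measure.nullSingletonClass_hausdorff _ one_pos
    exact measure_mono_null hsub ((finite_range _).measure_zero _)

/-- One-dimensional Hausdorff measure is additive over the tiles, as two of them share only finitely
many points of the side. -/
theorem side_eq_sum (h : IsTriangleTiling B C ρ) (j : Fin 3) :
    side B j = ∑ m, edgeCount B C j m * (ρ * side B m) := by
  classical
  have hNA : NullSingletonClass (μH[1] : Measure Plane) := Measure.nullSingletonClass_hausdorff _ one_pos
  have hnn : ∀ (i : Fin r), 0 ≤ ∑ m, if C i (m + 1) ∈ edge B j ∧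
      C i (m + 2) ∈ edge B j then ρ * side B m else 0 := fun i =>
    Finset.sum_nonneg fun m _ => by
      split_ifs
      · exact mul_nonneg h.pos.le (side_pos B m).le
      · exact le_rfl
  have hm : μH[1] (edge B j) = ∑ i, μH[1] (edge B j ∩ tri (C i)) := by
    conv_lhs => rw [h.edge_eq_iUnion j]
    rw [measure_iUnion₀, tsum_fintype]
    · intro i i' hne
      refine measure_mono_null (t := range B ∪ ⋃ i, range (C i)) ?_
        (((finite_range B).union (finite_iUnion fun i => finite_range (C i))).measure_zero _)
      rintro x ⟨⟨hx, hi⟩, -, hi'⟩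
      by_contra hnot
      simp only [mem_union, mem_range, mem_iUnion, not_or, not_exists] at hnot
      exact hne (h.subsingleton_tile_of_mem_edge hx (fun v hv => hnot.1 v hv.symm)
        (fun i m hm => hnot.2 i m hm.symm) hi hi')
    · exact fun i => ((isCompact_edge B j).inter_right
        (isCompact_tri (C i)).isClosed).measurableSet.nullMeasurableSet
  rw [Finset.sum_congr rfl fun i _ => h.hausdorffMeasure_edge_inter i j,
    ← ENNReal.ofReal_sum_of_nonneg fun i _ => hnn i, hausdorffMeasure_segment, edist_dist,
    ENNReal.ofReal_eq_ofReal_iff dist_nonneg (Finset.sum_nonneg fun i _ => hnn i)] at hm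
  rw [side, hm, Finset.sum_comm]
  refine Finset.sum_congr rfl fun m _ => ?_
  rw [← Finset.sum_filter, Finset.sum_const, nsmul_eq_mul, edgeCount]

theorem edgeCount_eq_zero_of_linearIndependent (h : IsTriangleTiling B C ρ)
    (hind : ∀ q : Fin 3 → ℚ, ∑ j, (q j : ℝ) * side B j = 0 → q = 0) {j m : Fin 3} (hjm : j ≠ m) :
    edgeCount B C j m = 0 := by
  have hr : r ≠ 0 := by
    rintro rfl
    have := h.mul_sq
    norm_num at this
  have hρ := h.pos
  have hs : (ρ⁻¹) ^ 2 = (r : ℝ) := by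
    have := h.mul_sq
    field_simp
    linarith
  have := Matrix.eq_zero_of_real_eigenvector_sq hind
    (Matrix.of fun j m => (edgeCount B C j m : ℚ)) hr hs (fun i => ?_) hjm
  · rw [Matrix.of_apply] at this
    exact_mod_cast this
  · conv_lhs => rw [h.side_eq_sum i, Finset.mul_sum]
    refine Finset.sum_congr rfl fun m _ => ?_
    simp only [Matrix.of_apply, Rat.cast_natCast]
    field_simp

/-- Points of side u tending to B v eventually avoid all tile vertices, so each lies on a tile side
contained in side u of B, which must be number u. A finite union of tile sides is closed, so the
limit B v lies on one as well. -/
theorem exists_edge_at_vertex (h : IsTriangleTiling B C ρ)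
    (hind : ∀ q : Fin 3 → ℚ, ∑ j, (q j : ℝ) * side B j = 0 → q = 0) {u v : Fin 3} (huv : u ≠ v) :
    ∃ i, B v ∈ edge (C i) u := by
  classical
  obtain ⟨t, ht, ht'⟩ : ∃ t, t ≠ v ∧ t ≠ u := by revert u v; decide
  let x : ℕ → Plane := fun n => AffineMap.lineMap (B v) (B t) (1 / ((n : ℝ) + 1))
  have hxE : ∀ n, x n ∈ edge B u := fun n => by
    have hn : (0 : ℝ) < 1 / ((n : ℝ) + 1) := by positivity
    have hn1 : 1 / ((n : ℝ) + 1) ≤ 1 := by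
      rw [div_le_one (by positivity)]; linarith [(Nat.cast_nonneg n : (0 : ℝ) ≤ n)]
    have hmem : x n ∈ segment ℝ (B v) (B t) := by
      rw [segment_eq_image_lineMap]; exact ⟨_, ⟨hn.le, hn1⟩, rfl⟩
    refine (convex_segment _ _).segment_subset ?_ ?_ hmem
    · exact (mem_edge_iff B (vertex_mem_tri B v)).2 (B.coord_apply_ne huv)
    · exact (mem_edge_iff B (vertex_mem_tri B t)).2 (B.coord_apply_ne ht'.symm)
  have hinj : Function.Injective x := fun a b hab => by
    have := AffineMap.lineMap_injective ℝ (B.ind.injective.ne ht.symm) hab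
    have ha : (0 : ℝ) < (a : ℝ) + 1 := by positivity
    have hb : (0 : ℝ) < (b : ℝ) + 1 := by positivity
    field_simp at this
    have : (a : ℝ) = b := by linarith
    exact_mod_cast this
  have hlim : Tendsto x atTop (𝓝 (B v)) := by
    have h1 : Continuous fun s : ℝ => (AffineMap.lineMap (B v) (B t) s : Plane) :=
      AffineMap.lineMap_continuous
    have := (h1.tendsto 0).comp (tendsto_one_div_add_atTop_nhds_zero_nat (𝕜 := ℝ))
    rw [AffineMap.lineMap_apply_zero] at this
    exact this
  have hclosed : IsClosed (⋃ i, edge (C i) u) :=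
    isClosed_iUnion_of_finite fun i => (isCompact_edge (C i) u).isClosed
  have hmem : B v ∈ ⋃ i, edge (C i) u := by
    refine hclosed.mem_of_tendsto hlim ?_
    have hfin : (⋃ i, range (C i)).Finite := finite_iUnion fun i => finite_range (C i)
    have hev : ∀ᶠ n in atTop, x n ∉ ⋃ i, range (C i) := by
      have := hinj.tendsto_cofinite.eventually hfin.compl_mem_cofinite
      rwa [Nat.cofinite_eq_atTop] at this
    filter_upwards [hev] with n hn
    have hx := hxE n
    rw [h.edge_eq_iUnion u] at hx
    obtain ⟨i, hi⟩ := mem_iUnion.1 hx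
    refine mem_iUnion.2 ⟨i, ?_⟩
    rcases edge_inter_tri B (h.tri_subset i) u with ⟨m, h0, h1, h2, he⟩ | ⟨-, hsub⟩
    · by_cases hm : u = m
      · subst hm; rwa [he] at hi
      · have := h.edgeCount_eq_zero_of_linearIndependent hind hm
        rw [edgeCount, Finset.card_eq_zero, Finset.filter_eq_empty_iff] at this
        exact absurd ⟨h1, h2⟩ (this (Finset.mem_univ i))
    · exact absurd (mem_iUnion.2 ⟨i, hsub hi⟩) hn
  exact mem_iUnion.1 hmem

end IsTriangleTiling

/-! ### Conclusion -/

/-- The affine basis of the plane formed by the vertices of a triangle. -/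
noncomputable def Affine.Triangle.affineBasis (T : Affine.Triangle ℝ Plane) :
    AffineBasis (Fin 3) ℝ Plane :=
  ⟨T.points, T.independent, by
    rw [T.independent.affineSpan_eq_top_iff_card_eq_finrank_add_one]; simp⟩

theorem IsTriangleTiling.ncard_vertex_lt_three {r : ℕ} {B : AffineBasis (Fin 3) ℝ Plane}
    {C : Fin r → AffineBasis (Fin 3) ℝ Plane} {ρ : ℝ} (h : IsTriangleTiling B C ρ)
    (hB : ∀ j, ang B j < Real.pi / 2) (v : Fin 3) : {i | B v ∈ tri (C i)}.ncard < 3 := by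
  obtain ⟨k, hv⟩ : ∃ k, {i | B v ∈ tri (C i)}.ncard = k := ⟨_, rfl⟩
  rw [hv]
  by_contra hlt
  have hk : 3 ≤ k := not_lt.1 hlt
  obtain ⟨u, t, hut, huv, htv, hcu, hct, hcv⟩ := h.exists_split_angle hB (by omega) hv
  have hk' : (3 : ℝ) ≤ k := by exact_mod_cast hk
  have hα := ang_pos_of_acute hB u
  have hγ : ang B v = k * ang B u := by
    have := (h.sum_cornerCount_vertex hB v).1
    rw [Fin.sum_three_of_ne hut huv htv, hcu, hct, hcv] at this
    rw [← this]; simp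
  have hβ : ang B t = Real.pi - (k + 1) * ang B u := by
    have := sum_ang B
    rw [Fin.sum_three_of_ne hut huv htv, hγ] at this
    linarith
  have h1 : 2 * k * ang B u < Real.pi := by have := hB v; rw [hγ] at this; linarith
  have h2 : Real.pi < 2 * (k + 1) * ang B u := by have := hB t; rw [hβ] at this; linarith
  have hsum : ∀ n : Fin 3 → ℕ, ∑ j, n j * ang B j = n u * ang B u +
      n t * (Real.pi - (k + 1) * ang B u) + n v * (k * ang B u) := fun n => by
    rw [Fin.sum_three_of_ne hut huv htv, hβ, hγ]
  by_cases hex : k = 3 ∧ (13 * ang B u = 2 * Real.pi ∨ 15 * ang B u = 2 * Real.pi)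
  · obtain ⟨rfl, hex⟩ := hex
    push_cast at hγ hβ
    obtain ⟨n, hn, hnα⟩ : ∃ n : ℕ, (n = 13 ∨ n = 15) ∧ n * ang B u = 2 * Real.pi := by
      rcases hex with hex | hex
      · exact ⟨13, Or.inl rfl, by exact_mod_cast hex⟩
      · exact ⟨15, Or.inr rfl, by exact_mod_cast hex⟩
    -- By the law of sines the sides are proportional to sin α, sin 4α, sin 3α, because β = π − 4α
    -- and γ = 3α.
    have hind : ∀ q : Fin 3 → ℚ, ∑ j, (q j : ℝ) * side B j = 0 → q = 0 := fun q hq => by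
      have hD := side_pos B u
      have e : (∑ j, (q j : ℝ) * Real.sin (ang B j)) * side B u = 0 := by
        rw [Finset.sum_mul]
        calc _ = ∑ j, Real.sin (ang B u) * ((q j : ℝ) * side B j) := by
              refine Finset.sum_congr rfl fun j _ => ?_
              rw [mul_assoc, sin_ang_mul_side B j u]; ring
          _ = 0 := by rw [← Finset.mul_sum, hq, mul_zero]
      have e := (mul_eq_zero.1 e).resolve_right hD.ne'
      rw [Fin.sum_three_of_ne hut huv htv, hγ, hβ, Real.sin_pi_sub] at e
      norm_num at e
      obtain ⟨e1, e2, e3⟩ := sin_linear_independent_rat hn hnα e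
      funext j
      have : j = u ∨ j = t ∨ j = v := by
        have := Finset.mem_univ j
        rw [Fin.univ_three_eq hut huv htv] at this
        simpa using this
      rcases this with rfl | rfl | rfl <;> assumption
    obtain ⟨i, hi⟩ := h.exists_edge_at_vertex hind huv
    have hit := edge_subset_tri (C i) u hi
    obtain ⟨j, hj⟩ := (h.sum_cornerCount_vertex hB v).2 i hit
    have hcj : cornerCount C (B v) j ≠ 0 := by
      classical
      rw [cornerCount, Finset.card_ne_zero]
      exact ⟨i, by simpa using hj⟩
    have hju : j = u := by
      have := Finset.mem_univ j
      rw [Fin.univ_three_eq hut huv htv] at this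
      simp only [Finset.mem_insert, Finset.mem_singleton] at this
      rcases this with rfl | rfl | rfl
      · rfl
      · exact absurd hct hcj
      · exact absurd hcv hcj
    -- The tile has B v both as its vertex u and on the side opposite to that vertex, so coordinate
    -- u would be 1 and 0.
    have h0 := (mem_edge_iff (C i) hit).1 hi
    rw [← hj, hju, (C i).coord_apply_eq] at h0
    exact one_ne_zero h0
  · obtain ⟨a, b, c, habc, hw0, hw1⟩ := exists_balancing_weights hk h1 h2 hex
    let w : Fin 3 → ℤ := fun j => if j = u then a else if j = t then b else c
    have hwsum : ∀ n : Fin 3 → ℤ, ∑ j, w j * n j = a * n u + b * n t + c * n v := fun n => by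
      rw [Fin.sum_three_of_ne hut huv htv]
      simp [w, hut.symm, huv.symm, htv.symm]
    refine h.false_of_weights hB huv hcu (fun j hj => ?_) (w := w) ?_ (fun n hn => ?_)
      (fun n hn hnu => ?_)
    · have : j = u ∨ j = t ∨ j = v := by
        have := Finset.mem_univ j
        rw [Fin.univ_three_eq hut huv htv] at this
        simpa using this
      rcases this with rfl | rfl | rfl
      · exact absurd rfl hj
      · rw [hβ]; nlinarith
      · rw [hγ]; nlinarith
    · have := hwsum 1
      simpa [habc] using this
    · rw [hsum] at hn
      rw [hwsum fun j => n j]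
      exact hw0 _ _ _ hn
    · rw [hsum] at hn
      rw [hwsum fun j => n j]
      exact hw1 _ _ _ hn hnu

theorem theorem9 (T : Affine.Triangle ℝ Plane) (hT : T.AcuteAngled) (k : ℕ) (hk : 3 ≤ k) :
    ¬ ∃ (r : ℕ) (tile : Fin r → Set Plane),
        IsReptiling T.closedInterior tile ∧ IsSplitting k T tile := by
  rintro ⟨r, tile, htile, -, v, hv⟩
  obtain ⟨C, ρ, h, hC⟩ := htile.exists_isTriangleTiling T.affineBasis
    (Affine.Simplex.convexHull_eq_closedInterior T)
  have hacute : ∀ j, ang T.affineBasis j < Real.pi / 2 := fun j =>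
    hT _ _ _ (Fin.ne_add_one j).symm (Fin.add_one_ne_add_two j) (Fin.ne_add_two j)
  have := h.ncard_vertex_lt_three hacute v
  simp only [hC] at hv
  change {i | T.points v ∈ tri (C i)}.ncard < 3 at this
  omega
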